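/- Let $n\ge 1$ and $\lambda_1,\dots,\lambda_n\in\mathbb{C}$. Let $$H^{D_n}=-\frac12\sum_{j=1}^n\frac{\partial^2}{\partial x_j^2}+\sum_{j=1}^{n-1}e^{x_{j+1}-x_j}+e^{-x_n-x_{n-1}}$$ be the quadratic Hamiltonian of the open Toda chain of type $D_n$ (for $n=1$ there is no potential: $H^{D_1}=-\frac12\partial_{x_1}^2$). For $k\ge1$, $x\in\mathbb{R}^{k+1}$, $x'\in\mathbb{R}^{k}$, $z\in\mathbb{C}^k$ put $$Q_{D_{k+1}}^{C_k}(x;z)=\exp\Big\{\sum_{i=1}^k\big(e^{z_i-x_i}+e^{x_{i+1}-z_i}\big)+e^{-x_{k+1}-z_k}\Big\},$$ $$Q_{C_k}^{D_k}(z;x')=\exp\Big\{\sum_{i=1}^{k-1}\big(e^{x'_i-z_i}+e^{z_{i+1}-x'_i}\big)+e^{x'_k-z_k}+e^{-x'_k-z_k}\Big\},$$ and, for $\lambda\in\mathbb{C}$, $$Q_{D_{k+1}}^{D_k}(x,x',\lambda)=\int_{(\mathbb{R}+i\pi)^k}\prod_{i=1}^k dz_i\; e^{i\lambda(\sum_{i=1}^{k+1}x_i+\sum_{i=1}^k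 x'_i-2\sum_{i=1}^k z_i)}\big(e^{-x_{k+1}}+e^{-x'_k}\big)^{2i\lambda}\,Q_{D_{k+1}}^{C_k}(x;z)\,Q_{C_k}^{D_k}(z;x').$$ For $x=(x_1,\dots,x_n)\in\mathbb{R}^n$ define, with $x_{n,i}:=x_i$ and $x_k=(x_{k,1},\dots,x_{k,k})$, $$\Psi^{D_n}_{\lambda_1,\dots,\lambda_n}(x)=\int_{\mathbb{R}^{n(n-1)/2}}\prod_{k=1}^{n-1}\prod_{i=1}^k dx_{k,i}\; e^{i\lambda_1x_{1,1}}\prod_{k=1}^{n-1}Q_{D_{k+1}}^{D_k}(x_{k+1},x_k,\lambda_{k+1}).$$ (1) The integrals defining the kernels $Q_{D_{k+1}}^{D_k}(x,x',\lambda_{k+1})$, $1\le k\le n-1$, and the integral defining $\Psi^{D_n}_{\lambda_1,\dots,\lambda_n}(x)$ converge absolutely for all real arguments; $\Psi^{D_n}_{\lambda_1,\dots,\lambda_n}$ is twice continuously differentiable on $\mathbb{R}^n$, and $$H^{D_n}\,\Psi^{D_n}_{\lambda_1,\dots,\lambda_n}=\frac12\Big(\sum_{i=1}^n\lambda_i^2\Big)\Psi^{D_n}_{\lambda_1,\dots,\lambda_n}.$$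 (2) Let $1\le k\le n-1$, $\lambda=\lambda_{k+1}$, and let $\theta\in\mathbb{R}$ satisfy $|\theta|<\pi/2$ and $\operatorname{Im}(\lambda e^{i\theta})>0$. Let $C_\theta$ be the contour that runs along $i\pi+(-\infty,0]$ and then along the ray $i\pi+e^{i\theta}[0,\infty)$ (so $C_0=\mathbb{R}+i\pi$, which is admissible if $\operatorname{Im}\lambda>0$; for real $\lambda\neq0$ the condition says that $\theta$ has the sign of $\lambda$ and is nonzero). Then for all $x\in\mathbb{R}^{k+1}$, $x'\in\mathbb{R}^k$ $$Q_{D_{k+1}}^{D_k}(x,x',\lambda)=\frac{e^{2\pi\lambda}}{\Gamma(-2i\lambda)}\int_{(\mathbb{R}+i\pi)^k\times C_\theta}\prod_{i=1}^k dz_i\,dy\; e^{i\lambda(\sum_{i=1}^{k+1} x_i+\sum_{i=1}^k x'_i-2\sum_{i=1}^k z_i+2y)}\,Q_{D_{k+1}}^{C_k}(x;z,y)\,Q_{C_k}^{D_k}(z;x',y),$$ with an absolutely convergent integral, where $Q_{D_{k+1}}^{C_k}(x;z,y)=Q_{D_{k+1}}^{C_k}(x;z)\exp(e^{-x_{k+1}-y})$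 and $Q_{C_k}^{D_k}(z;x',y)=Q_{C_k}^{D_k}(z;x')\exp(e^{-x'_k-y})$. -/

import Mathlib

open MeasureTheory

namespace TodaD

noncomputable section

/-- The boundary term of the potential of the open Toda chain of type `D_{m+1}`:
`e^{-x_n-x_{n-1}}` with `n = m + 1`; it is absent in rank one. -/
def boundaryPotential : (m : ℕ) → (Fin (m + 1) → ℝ) → ℝ
  | 0, _ => 0
  | m + 1, x => Real.exp (-x (Fin.last (m + 1)) - x (Fin.last m).castSucc)

/-- The quadratic Hamiltonian of the open Toda chain of type `D_n`, `n = m + 1`: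
`-(1/2) ∑ ∂²/∂x_j² + ∑_{j<n} e^{x_{j+1}-x_j} + e^{-x_n-x_{n-1}}`. -/
def hamiltonian (m : ℕ) (f : (Fin (m + 1) → ℝ) → ℂ) (x : Fin (m + 1) → ℝ) : ℂ :=
  -(1 / 2 : ℂ) * ∑ j, iteratedDeriv 2 (fun t : ℝ => f (Function.update x j t)) (x j)
    + (((∑ j : Fin m, Real.exp (x j.succ - x j.castSucc)) + boundaryPotential m x : ℝ) : ℂ) * f x

/-- The elementary kernel `Q_{D_{k+1}}^{C_k}(x; z)`, `k = r + 1`. -/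
def kernelDC (r : ℕ) (x : Fin (r + 2) → ℝ) (z : Fin (r + 1) → ℂ) : ℂ :=
  Complex.exp
    ((∑ i : Fin (r + 1), (Complex.exp (z i - x i.castSucc) + Complex.exp (x i.succ - z i)))
      + Complex.exp (-x (Fin.last (r + 1)) - z (Fin.last r)))

/-- The elementary kernel `Q_{C_k}^{D_k}(z; x')`, `k = r + 1`. -/
def kernelCD (r : ℕ) (z : Fin (r + 1) → ℂ) (x' : Fin (r + 1) → ℝ) : ℂ :=
  Complex.exp
    ((∑ i : Fin r, (Complex.exp (x' i.castSucc - z i.castSucc)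
        + Complex.exp (z i.succ - x' i.castSucc)))
      + Complex.exp (x' (Fin.last r) - z (Fin.last r))
      + Complex.exp (-x' (Fin.last r) - z (Fin.last r)))

/-- Parametrization of the integration contour `(ℝ + iπ)^k` of the variables `z`. -/
def zContour {k : ℕ} (t : Fin k → ℝ) (i : Fin k) : ℂ := t i + Real.pi * Complex.I

/-- The integrand, in the parameter `t` of the contour `z = t + iπ`, of the recursive kernel
`Q_{D_{k+1}}^{D_k}(x, x', lam)`, `k = r + 1`. -/
def recIntegrand (r : ℕ) (lam : ℂ) (x : Fin (r + 2) → ℝ) (x' : Fin (r + 1) → ℝ)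
    (t : Fin (r + 1) → ℝ) : ℂ :=
  Complex.exp (Complex.I * lam *
      ((∑ i, (x i : ℂ)) + (∑ i, (x' i : ℂ)) - 2 * ∑ i, zContour t i))
    * ((Real.exp (-x (Fin.last (r + 1))) + Real.exp (-x' (Fin.last r)) : ℝ) : ℂ)
        ^ (2 * Complex.I * lam)
    * kernelDC r x (zContour t) * kernelCD r (zContour t) x'

/-- The recursive kernel `Q_{D_{k+1}}^{D_k}(x, x', lam)`, `k = r + 1`. -/
def recKernel (r : ℕ) (lam : ℂ) (x : Fin (r + 2) → ℝ) (x' : Fin (r + 1) → ℝ) : ℂ :=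
  ∫ t : Fin (r + 1) → ℝ, recIntegrand r lam x x' t

/-- The triangular arrays `(x_{k,i})`, `1 ≤ k ≤ m`, `1 ≤ i ≤ k`; the row with index `k` here
has `k + 1` entries. -/
abbrev Triangle (m : ℕ) : Type := (k : Fin m) → Fin ((k : ℕ) + 1) → ℝ

/-- The triangle completed by the bottom row `x_{n,i} = x_i`, `n = m + 1`. -/
def complete {m : ℕ} (X : Triangle m) (x : Fin (m + 1) → ℝ) : Triangle (m + 1) :=
  Fin.snoc (α := fun k : Fin (m + 1) => Fin ((k : ℕ) + 1) → ℝ) X x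

/-- The integrand `e^{i lam_1 x_{11}} ∏_{k=1}^{n-1} Q_{D_{k+1}}^{D_k}(x_{k+1}, x_k, lam_{k+1})`
of the wave function, `n = m + 1`. -/
def waveIntegrand (m : ℕ) (lam : Fin (m + 1) → ℂ) (x : Fin (m + 1) → ℝ) (X : Triangle m) : ℂ :=
  Complex.exp (Complex.I * lam 0 * (complete X x 0 0 : ℝ))
    * ∏ k : Fin m, recKernel k (lam k.succ) (complete X x k.succ) (complete X x k.castSucc)

/-- The wave function `Ψ^{D_n}_{lam_1, …, lam_n}(x_1, …, x_n)`, `n = m + 1`. -/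
def wave (m : ℕ) (lam : Fin (m + 1) → ℂ) (x : Fin (m + 1) → ℝ) : ℂ :=
  ∫ X : Triangle m, waveIntegrand m lam x X

/-- `Q_{D_{k+1}}^{C_k}(x; z, y)`, `k = r + 1`. -/
def kernelDCy (r : ℕ) (x : Fin (r + 2) → ℝ) (z : Fin (r + 1) → ℂ) (y : ℂ) : ℂ :=
  Complex.exp
    ((∑ i : Fin (r + 1), (Complex.exp (z i - x i.castSucc) + Complex.exp (x i.succ - z i)))
      + Complex.exp (-x (Fin.last (r + 1)) - z (Fin.last r))
      + Complex.exp (-x (Fin.last (r + 1)) - y))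

/-- `Q_{C_k}^{D_k}(z; x', y)`, `k = r + 1`. -/
def kernelCDy (r : ℕ) (z : Fin (r + 1) → ℂ) (x' : Fin (r + 1) → ℝ) (y : ℂ) : ℂ :=
  Complex.exp
    ((∑ i : Fin r, (Complex.exp (x' i.castSucc - z i.castSucc)
        + Complex.exp (z i.succ - x' i.castSucc)))
      + Complex.exp (x' (Fin.last r) - z (Fin.last r))
      + Complex.exp (-x' (Fin.last r) - z (Fin.last r))
      + Complex.exp (-x' (Fin.last r) - y))

/-- The contour of the variable `y`: the half-line `iπ + (-∞, 0]` followed by the ray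
`iπ + e^{iθ} [0, ∞)`. For `θ = 0` it is the line `ℝ + iπ`. -/
def yContour (θ s : ℝ) : ℂ :=
  Real.pi * Complex.I + (if s ≤ 0 then (s : ℂ) else s * Complex.exp (θ * Complex.I))

/-- The velocity `dy/ds` along `yContour θ`. -/
def yVelocity (θ s : ℝ) : ℂ := if s ≤ 0 then 1 else Complex.exp (θ * Complex.I)

/-- The integrand of the second form of the recursive kernel in the parameters `(t, s)` of the
contours `z = t + iπ`, `y = yContour θ s`. -/
def altIntegrand (r : ℕ) (lam : ℂ) (θ : ℝ) (x : Fin (r + 2) → ℝ) (x' : Fin (r + 1) → ℝ)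
    (p : (Fin (r + 1) → ℝ) × ℝ) : ℂ :=
  Complex.exp (Complex.I * lam *
      ((∑ i, (x i : ℂ)) + (∑ i, (x' i : ℂ)) - 2 * (∑ i, zContour p.1 i) + 2 * yContour θ p.2))
    * kernelDCy r x (zContour p.1) (yContour θ p.2)
    * kernelCDy r (zContour p.1) x' (yContour θ p.2)
    * yVelocity θ p.2

end

end TodaD

/-! On the contour z = t + iπ every exponential in z changes sign. The integrand of the recursive
kernel becomes K = c · e^{iλℓ} · S^{2iλ} · exp(-∑ e^L), with real linear forms ℓ and L in (x, x', t)
and S = e^{-x_{k+1}} + e^{-x'_k}. Upper bounds on all the forms L confine (x', t) once x is fixed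
(`termForm_bound`). Hence K decays faster than any exponential in (x', t), with at most exponential
growth in x. Every derivative of K is K times a function of exponential growth, so it decays in the
same way (`rapid_todaKernel`). This justifies convergence, differentiation under the integral and
integration by parts.

The eigenfunction equation is an induction on the rank. Before any integration the kernel
intertwines the two Hamiltonians up to a divergence in t: H_x K = (H_{x'} + λ²/2) K + ∑
∂_{t_i}(flux_i K) (`todaKernel_intertwining`). Behind it lies an identity between the exponential
terms (`toda_identity`): products of neighbouring terms are the potentials, mixed products agree on
both sides, and the derivatives of S^{2iλ} repair the mismatch at the last site. Integrated against
an eigenfunction f(x'), the divergence vanishes and two integrations by parts move H_{x'} onto f, so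
each step adds λ²/2 to the eigenvalue (`hamiltonian_raise`). The induction starts at a plane wave,
and Fubini (`wave_succ`) identifies the wave function with the iterated operator.

In the second form the variable y separates. With y = w + iπ and a = -2iλ its integral is ∫ e^{-aw}
exp(-S e^{-w}) dw = Γ(a) S^{-a}. On the bent contour this is proved without Cauchy's theorem. On the
ray the outer exponential expands into the series ∑ (-S)^n / (n! (a + n)), which does not see the
direction of the ray. So for Re a > 0 the contour may be straightened, and a recursion from a + 1 to
a covers the other values (`integral_gammaIntegrand_ray`). -/

namespace TodaD

set_option linter.unusedSectionVars false

noncomputable section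

/-! ### Function classes: exponential growth and rapid decay, with derivatives -/

section ControlClasses

variable {W X : Type*} [NormedAddCommGroup W] [NormedSpace ℝ W]
  [NormedAddCommGroup X] [NormedSpace ℝ X]

/-- The functions whose directional derivatives up to order `n` exist and all have the
property `𝓑` (a growth condition). -/
def ControlledBy (𝓑 : (W → ℂ) → Prop) : ℕ → (W → ℂ) → Prop
  | 0, f => Continuous f ∧ 𝓑 f
  | n + 1, f => Differentiable ℝ f ∧ 𝓑 f ∧ ∀ v, ControlledBy 𝓑 n (fun w => fderiv ℝ f w v)

/-- At most exponential growth. -/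
def ExpBounded (f : W → ℂ) : Prop := ∃ C A : ℝ, ∀ w, ‖f w‖ ≤ C * Real.exp (A * ‖w‖)

/-- Decay faster than any exponential in the second variable, with at most exponential growth
in the first one. -/
def RapidlyDecaying (f : W × X → ℂ) : Prop :=
  ∀ B : ℝ, ∃ C A : ℝ, ∀ x y, ‖f (x, y)‖ ≤ C * Real.exp (A * ‖x‖ - B * ‖y‖)

variable {𝓑 𝓑' : (W → ℂ) → Prop}

theorem ControlledBy.bound {n : ℕ} {f : W → ℂ} (h : ControlledBy 𝓑 n f) : 𝓑 f := by
  cases n with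
  | zero => exact h.2
  | succ n => exact h.2.1

theorem ControlledBy.continuous {n : ℕ} {f : W → ℂ} (h : ControlledBy 𝓑 n f) :
    Continuous f := by
  cases n with
  | zero => exact h.1
  | succ n => exact h.1.continuous

theorem ControlledBy.pred {n : ℕ} {f : W → ℂ} (h : ControlledBy 𝓑 (n + 1) f) :
    ControlledBy 𝓑 n f := by
  induction n generalizing f with
  | zero => exact ⟨h.1.continuous, h.2.1⟩
  | succ n ih => exact ⟨h.1, h.2.1, fun v => ih (h.2.2 v)⟩

theorem ControlledBy.contDiff [FiniteDimensional ℝ W] {n : ℕ} {f : W → ℂ}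
    (h : ControlledBy 𝓑 n f) : ContDiff ℝ n f := by
  induction n generalizing f with
  | zero => exact contDiff_zero.2 h.1
  | succ n ih =>
    rw [Nat.cast_succ, contDiff_succ_iff_fderiv_apply]
    exact ⟨h.1, by simp, fun v => ih (h.2.2 v)⟩

theorem ControlledBy.add (hadd : ∀ f g, 𝓑 f → 𝓑 g → 𝓑 (fun w => f w + g w)) {n : ℕ}
    {f g : W → ℂ} (hf : ControlledBy 𝓑 n f) (hg : ControlledBy 𝓑 n g) :
    ControlledBy 𝓑 n (fun w => f w + g w) := by
  induction n generalizing f g with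
  | zero => exact ⟨hf.1.add hg.1, hadd _ _ hf.2 hg.2⟩
  | succ n ih =>
    refine ⟨hf.1.add hg.1, hadd _ _ hf.2.1 hg.2.1, fun v => ?_⟩
    have : (fun w => fderiv ℝ (fun w => f w + g w) w v)
        = fun w => fderiv ℝ f w v + fderiv ℝ g w v := by
      funext w
      rw [fderiv_fun_add (hf.1 w) (hg.1 w)]
      rfl
    rw [this]
    exact ih (hf.2.2 v) (hg.2.2 v)

/-- Leibniz rule and induction on the order. Two growth conditions are allowed so that one argument
covers tame times tame and tame times rapidly decaying. -/
theorem ControlledBy.mul (hadd : ∀ f g, 𝓑' f → 𝓑' g → 𝓑' (fun w => f w + g w))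
    (hmul : ∀ f g, 𝓑 f → 𝓑' g → 𝓑' (fun w => f w * g w)) {n : ℕ}
    {f g : W → ℂ} (hf : ControlledBy 𝓑 n f) (hg : ControlledBy 𝓑' n g) :
    ControlledBy 𝓑' n (fun w => f w * g w) := by
  induction n generalizing f g with
  | zero => exact ⟨hf.1.mul hg.1, hmul _ _ hf.2 hg.2⟩
  | succ n ih =>
    refine ⟨hf.1.mul hg.1, hmul _ _ hf.2.1 hg.2.1, fun v => ?_⟩
    have : (fun w => fderiv ℝ (fun w => f w * g w) w v)
        = fun w => f w * fderiv ℝ g w v + fderiv ℝ f w v * g w := by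
      funext w
      rw [fderiv_fun_mul (hf.1 w) (hg.1 w)]
      simp [mul_comm]
    rw [this]
    exact (ih hf.pred (hg.2.2 v)).add hadd (ih (hf.2.2 v) hg.pred)

theorem ExpBounded.exists_pos {f : W → ℂ} (h : ExpBounded f) :
    ∃ C A : ℝ, 0 ≤ C ∧ 0 ≤ A ∧ ∀ w, ‖f w‖ ≤ C * Real.exp (A * ‖w‖) := by
  obtain ⟨C, A, h⟩ := h
  refine ⟨|C|, |A|, abs_nonneg _, abs_nonneg _, fun w => (h w).trans ?_⟩
  gcongr
  · exact le_abs_self C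
  · exact le_abs_self A

theorem ExpBounded.add (f g : W → ℂ) (hf : ExpBounded f) (hg : ExpBounded g) :
    ExpBounded (fun w => f w + g w) := by
  obtain ⟨C, A, hC, hA, hf⟩ := hf.exists_pos
  obtain ⟨D, B, hD, hB, hg⟩ := hg.exists_pos
  refine ⟨C + D, A + B, fun w => (norm_add_le _ _).trans ?_⟩
  have h1 : Real.exp (A * ‖w‖) ≤ Real.exp ((A + B) * ‖w‖) := by gcongr; linarith
  have h2 : Real.exp (B * ‖w‖) ≤ Real.exp ((A + B) * ‖w‖) := by gcongr; linarith
  nlinarith [hf w, hg w, mul_le_mul_of_nonneg_left h1 hC, mul_le_mul_of_nonneg_left h2 hD]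

theorem ExpBounded.mul (f g : W → ℂ) (hf : ExpBounded f) (hg : ExpBounded g) :
    ExpBounded (fun w => f w * g w) := by
  obtain ⟨C, A, hC, hA, hf⟩ := hf.exists_pos
  obtain ⟨D, B, hD, hB, hg⟩ := hg.exists_pos
  refine ⟨C * D, A + B, fun w => ?_⟩
  rw [norm_mul, add_mul, Real.exp_add, mul_mul_mul_comm]
  exact mul_le_mul (hf w) (hg w) (norm_nonneg _) (by positivity)

theorem RapidlyDecaying.exists_pos {f : W × X → ℂ} (h : RapidlyDecaying f) (B : ℝ) :
    ∃ C A : ℝ, 0 ≤ C ∧ 0 ≤ A ∧ ∀ x y, ‖f (x, y)‖ ≤ C * Real.exp (A * ‖x‖ - B * ‖y‖) := by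
  obtain ⟨C, A, h⟩ := h B
  refine ⟨|C|, |A|, abs_nonneg _, abs_nonneg _, fun x y => (h x y).trans ?_⟩
  gcongr
  · exact le_abs_self C
  · exact le_abs_self A

theorem RapidlyDecaying.add (f g : W × X → ℂ) (hf : RapidlyDecaying f)
    (hg : RapidlyDecaying g) : RapidlyDecaying (fun w => f w + g w) := by
  intro B
  obtain ⟨C, A, hC, hA, hf⟩ := hf.exists_pos B
  obtain ⟨D, A', hD, hB, hg⟩ := hg.exists_pos B
  refine ⟨C + D, A + A', fun x y => (norm_add_le _ _).trans ?_⟩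
  have h1 : Real.exp (A * ‖x‖ - B * ‖y‖) ≤ Real.exp ((A + A') * ‖x‖ - B * ‖y‖) := by
    gcongr; linarith
  have h2 : Real.exp (A' * ‖x‖ - B * ‖y‖) ≤ Real.exp ((A + A') * ‖x‖ - B * ‖y‖) := by
    gcongr; linarith
  nlinarith [hf x y, hg x y, mul_le_mul_of_nonneg_left h1 hC, mul_le_mul_of_nonneg_left h2 hD]

/-- Rapid decay holds at every rate, so the rate B + A can be requested of `g`, and the growth
e^{A‖y‖} of `f` is absorbed. -/
theorem ExpBounded.mul_rapidlyDecaying (f g : W × X → ℂ) (hf : ExpBounded f)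
    (hg : RapidlyDecaying g) : RapidlyDecaying (fun w => f w * g w) := by
  intro B
  obtain ⟨C, A, hC, hA, hf⟩ := hf.exists_pos
  obtain ⟨D, A', hD, hB, hg⟩ := hg.exists_pos (B + A)
  refine ⟨C * D, A + A', fun x y => ?_⟩
  have hn : ‖(x, y)‖ ≤ ‖x‖ + ‖y‖ := by
    rw [Prod.norm_mk]
    exact max_le (by linarith [norm_nonneg y]) (by linarith [norm_nonneg x])
  rw [norm_mul]
  calc ‖f (x, y)‖ * ‖g (x, y)‖
      ≤ (C * Real.exp (A * ‖(x, y)‖)) * (D * Real.exp (A' * ‖x‖ - (B + A) * ‖y‖)) :=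
        mul_le_mul (hf _) (hg x y) (norm_nonneg _) (by positivity)
    _ = C * D * Real.exp (A * ‖(x, y)‖ + (A' * ‖x‖ - (B + A) * ‖y‖)) := by
        rw [Real.exp_add]; ring
    _ ≤ C * D * Real.exp ((A + A') * ‖x‖ - B * ‖y‖) := by
        gcongr
        nlinarith

/-- Functions of exponential growth together with their derivatives up to order `n`. -/
abbrev Tame (n : ℕ) (f : W → ℂ) : Prop := ControlledBy ExpBounded n f

/-- Functions of rapid decay together with their derivatives up to order `n`. -/
abbrev Rapid (n : ℕ) (f : W × X → ℂ) : Prop := ControlledBy RapidlyDecaying n f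

theorem Tame.add {n : ℕ} {f g : W → ℂ} (hf : Tame n f) (hg : Tame n g) :
    Tame n (fun w => f w + g w) := ControlledBy.add ExpBounded.add hf hg

theorem Tame.mul {n : ℕ} {f g : W → ℂ} (hf : Tame n f) (hg : Tame n g) :
    Tame n (fun w => f w * g w) := ControlledBy.mul ExpBounded.add ExpBounded.mul hf hg

theorem Tame.mul_rapid {n : ℕ} {f g : W × X → ℂ} (hf : Tame n f) (hg : Rapid n g) :
    Rapid n (fun w => f w * g w) :=
  ControlledBy.mul RapidlyDecaying.add ExpBounded.mul_rapidlyDecaying hf hg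

theorem Tame.const (n : ℕ) (c : ℂ) : Tame n (fun _ : W => c) := by
  induction n generalizing c with
  | zero => exact ⟨continuous_const, ‖c‖, 0, by simp⟩
  | succ n ih =>
    refine ⟨differentiable_const c, ⟨‖c‖, 0, by simp⟩, fun v => ?_⟩
    simpa using ih 0

theorem Tame.const_mul {n : ℕ} {f : W → ℂ} (c : ℂ) (hf : Tame n f) :
    Tame n (fun w => c * f w) := (Tame.const n c).mul hf

theorem Tame.neg {n : ℕ} {f : W → ℂ} (hf : Tame n f) : Tame n (fun w => -f w) := by
  simpa using hf.const_mul (-1)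

theorem Tame.sub {n : ℕ} {f g : W → ℂ} (hf : Tame n f) (hg : Tame n g) :
    Tame n (fun w => f w - g w) := by
  simpa [sub_eq_add_neg] using hf.add hg.neg

theorem Tame.sum {n : ℕ} {ι : Type*} (s : Finset ι) {f : ι → W → ℂ}
    (hf : ∀ i ∈ s, Tame n (f i)) : Tame n (fun w => ∑ i ∈ s, f i w) := by
  classical
  induction s using Finset.induction_on with
  | empty => simpa using Tame.const n (0 : ℂ)
  | insert a s ha ih =>
    simp only [Finset.sum_insert ha]
    exact (hf a (by simp)).add (ih fun i hi => hf i (by simp [hi]))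

theorem Tame.comp_clm {n : ℕ} {f : W → ℂ} (hf : Tame n f) (L : X →L[ℝ] W) :
    Tame n (fun x => f (L x)) := by
  have hb : ∀ g : W → ℂ, ExpBounded g → ExpBounded (fun x => g (L x)) := by
    intro g hg
    obtain ⟨C, A, hC, hA, hg⟩ := hg.exists_pos
    refine ⟨C, A * ‖L‖, fun x => (hg _).trans ?_⟩
    rw [mul_assoc]
    gcongr
    exact L.le_opNorm x
  induction n generalizing f with
  | zero => exact ⟨hf.1.comp L.continuous, hb _ hf.2⟩
  | succ n ih =>
    refine ⟨hf.1.comp L.differentiable, hb _ hf.2.1, fun v => ?_⟩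
    have : (fun x => fderiv ℝ (fun x => f (L x)) x v) = fun x => fderiv ℝ f (L x) (L v) := by
      funext x
      have := ((hf.1 (L x)).hasFDerivAt.comp x L.hasFDerivAt).fderiv
      rw [Function.comp_def] at this
      rw [this]
      rfl
    rw [this]
    exact ih (hf.2.2 (L v))

theorem hasFDerivAt_cexp_clm (L : W →L[ℝ] ℝ) (w : W) :
    HasFDerivAt (fun w => Complex.exp (L w : ℂ))
      (Complex.exp (L w : ℂ) • (Complex.ofRealCLM.comp L)) w :=
  ((Complex.ofRealCLM.comp L).hasFDerivAt (x := w)).cexp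

theorem fderiv_cexp_const_mul_clm (c : ℂ) (L : W →L[ℝ] ℝ) (w v : W) :
    fderiv ℝ (fun w => Complex.exp (c * L w)) w v = c * L v * Complex.exp (c * L w) := by
  have h : HasFDerivAt (fun w => Complex.exp (c * L w)) _ w :=
    (((Complex.ofRealCLM.comp L).hasFDerivAt (x := w)).const_mul c).cexp
  rw [h.fderiv]
  simp [mul_comm]

theorem Tame.cexp_const_mul_clm (n : ℕ) (c : ℂ) (L : W →L[ℝ] ℝ) :
    Tame n (fun w => Complex.exp (c * L w)) := by
  have hb : ExpBounded (fun w => Complex.exp (c * L w)) := by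
    refine ⟨1, ‖c‖ * ‖L‖, fun w => ?_⟩
    rw [Complex.norm_exp, one_mul, mul_assoc]
    gcongr
    refine (Complex.re_le_norm _).trans ?_
    rw [norm_mul, Complex.norm_real]
    gcongr
    exact L.le_opNorm w
  induction n with
  | zero => exact ⟨by fun_prop, hb⟩
  | succ n ih =>
    refine ⟨fun w =>
      (((Complex.ofRealCLM.comp L).hasFDerivAt (x := w)).const_mul c).cexp.differentiableAt,
      hb, fun v => ?_⟩
    simp only [fderiv_cexp_const_mul_clm]
    exact ih.const_mul _

theorem Tame.cexp_clm (n : ℕ) (L : W →L[ℝ] ℝ) : Tame n (fun w => Complex.exp (L w : ℂ)) := by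
  simpa using Tame.cexp_const_mul_clm n 1 L

end ControlClasses

/-! ### Integrals with a parameter: regularity and integration by parts -/

section ParametricIntegral

variable {E Y : Type*} [NormedAddCommGroup E] [NormedSpace ℝ E] [FiniteDimensional ℝ E]
  [NormedAddCommGroup Y] [NormedSpace ℝ Y] [FiniteDimensional ℝ Y]
  [MeasurableSpace Y] [BorelSpace Y] {μ : Measure Y} [μ.IsAddHaarMeasure]

theorem one_add_pow_le_exp {s : ℝ} (hs : 0 ≤ s) (n : ℕ) :
    (1 + s) ^ n ≤ n.factorial * Real.exp (1 + s) := by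
  have := Real.pow_div_factorial_le_exp (1 + s) (by linarith) n
  rwa [div_le_iff₀' (by positivity)] at this

theorem integrable_exp_neg_norm : Integrable (fun y : Y => Real.exp (-‖y‖)) μ := by
  -- The power (1 + ‖y‖)^{-d} is integrable as soon as d exceeds the dimension.
  set d := Module.finrank ℝ Y + 1 with hd
  have h := (integrable_one_add_norm (E := Y) (μ := μ) (r := (d : ℝ)) (by simp [hd])).const_mul
    (d.factorial * Real.exp 1)
  refine h.mono' (by fun_prop) (Filter.Eventually.of_forall fun y => ?_)
  have h1 := one_add_pow_le_exp (norm_nonneg y) d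
  rw [Real.norm_of_nonneg (Real.exp_pos _).le, Real.rpow_neg (by positivity), Real.rpow_natCast,
    Real.exp_neg, ← div_eq_mul_inv, le_div_iff₀ (by positivity), inv_mul_le_iff₀ (by positivity)]
  rw [Real.exp_add] at h1
  linarith

/-- Decay at rate A + 1 beats the growth e^{A‖y‖} of `φ` and leaves e^{-‖y‖}, the integrable
majorant used throughout. -/
theorem RapidlyDecaying.mul_bound {F : E × Y → ℂ} {φ : Y → ℂ} (hF : RapidlyDecaying F)
    (hφ : ExpBounded φ) : ∃ C A : ℝ, 0 ≤ C ∧ 0 ≤ A ∧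
      ∀ x y, ‖F (x, y)‖ * ‖φ y‖ ≤ C * Real.exp (A * ‖x‖) * Real.exp (-‖y‖) := by
  obtain ⟨C, A, hC, hA, hφ⟩ := hφ.exists_pos
  obtain ⟨D, A', hD, hA', hF⟩ := hF.exists_pos (A + 1)
  refine ⟨D * C, A', by positivity, hA', fun x y => ?_⟩
  calc ‖F (x, y)‖ * ‖φ y‖
      ≤ (D * Real.exp (A' * ‖x‖ - (A + 1) * ‖y‖)) * (C * Real.exp (A * ‖y‖)) :=
        mul_le_mul (hF x y) (hφ y) (norm_nonneg _) (by positivity)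
    _ = D * C * (Real.exp (A' * ‖x‖ - (A + 1) * ‖y‖) * Real.exp (A * ‖y‖)) := by ring
    _ = D * C * Real.exp (A' * ‖x‖) * Real.exp (-‖y‖) := by
        rw [mul_assoc (D * C), ← Real.exp_add, ← Real.exp_add]
        ring_nf

theorem Rapid.integrable_mul {F : E × Y → ℂ} {φ : Y → ℂ} {n k : ℕ} (hF : Rapid n F)
    (hφ : Tame k φ) (x : E) : Integrable (fun y => F (x, y) * φ y) μ := by
  obtain ⟨C, A, -, -, h⟩ := hF.bound.mul_bound hφ.bound
  have hF' := hF.continuous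
  have hφ' := hφ.continuous
  refine (integrable_exp_neg_norm.const_mul (C * Real.exp (A * ‖x‖))).mono'
    (by fun_prop) (Filter.Eventually.of_forall fun y => ?_)
  rw [norm_mul]
  exact h x y

/-- The class controls directional derivatives only. In finite dimension the operator norm is
controlled by the values on a basis, so finitely many of those bounds suffice. -/
theorem Rapid.fderiv_bound {F : E × Y → ℂ} {n : ℕ} (hF : Rapid (n + 1) F) (B : ℝ) :
    ∃ C A : ℝ, 0 ≤ C ∧ 0 ≤ A ∧
      ∀ x y, ‖fderiv ℝ F (x, y)‖ ≤ C * Real.exp (A * ‖x‖ - B * ‖y‖) := by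
  let b := Module.finBasis ℝ (E × Y)
  obtain ⟨K, hK, hb⟩ := b.exists_opNorm_le (F := ℂ)
  choose C A hC hA h using fun i => (hF.2.2 (b i)).bound.exists_pos B
  refine ⟨K * ∑ i, C i, ∑ i, A i, mul_nonneg hK.le (Finset.sum_nonneg fun i _ => hC i),
    Finset.sum_nonneg fun i _ => hA i, fun x y => ?_⟩
  rw [mul_assoc]
  refine hb (mul_nonneg (Finset.sum_nonneg fun i _ => hC i) (Real.exp_pos _).le)
    fun i => (h i x y).trans ?_
  have h1 : C i ≤ ∑ i, C i := Finset.single_le_sum (fun i _ => hC i) (Finset.mem_univ i)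
  have h2 : A i ≤ ∑ i, A i := Finset.single_le_sum (fun i _ => hA i) (Finset.mem_univ i)
  have h3 := hC i
  gcongr
  exact h3.trans h1

theorem Rapid.norm_smul_fderiv_comp_inl_le {F : E × Y → ℂ} {φ : Y → ℂ} {n : ℕ}
    (hF : Rapid (n + 1) F) (hφ : ExpBounded φ) : ∃ C A : ℝ, 0 ≤ C ∧ 0 ≤ A ∧ ∀ x y,
      ‖φ y • (fderiv ℝ F (x, y)).comp (ContinuousLinearMap.inl ℝ E Y)‖
        ≤ C * Real.exp (A * ‖x‖) * Real.exp (-‖y‖) := by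
  obtain ⟨D, A, hD, hA, hφb⟩ := hφ.exists_pos
  obtain ⟨C, A', hC, hA', hFb⟩ := hF.fderiv_bound (A + 1)
  refine ⟨D * C, A', by positivity, hA', fun x y => ?_⟩
  have hcomp : ‖(fderiv ℝ F (x, y)).comp (ContinuousLinearMap.inl ℝ E Y)‖
      ≤ ‖fderiv ℝ F (x, y)‖ := by
    refine (ContinuousLinearMap.opNorm_comp_le _ _).trans ?_
    exact mul_le_of_le_one_right (norm_nonneg _)
      (ContinuousLinearMap.norm_inl_le_one ℝ E Y)
  rw [norm_smul]
  calc ‖φ y‖ * ‖(fderiv ℝ F (x, y)).comp (ContinuousLinearMap.inl ℝ E Y)‖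
      ≤ (D * Real.exp (A * ‖y‖)) * (C * Real.exp (A' * ‖x‖ - (A + 1) * ‖y‖)) :=
        mul_le_mul (hφb y) (hcomp.trans (hFb x y)) (norm_nonneg _) (by positivity)
    _ = D * C * (Real.exp (A * ‖y‖) * Real.exp (A' * ‖x‖ - (A + 1) * ‖y‖)) := by ring
    _ = D * C * Real.exp (A' * ‖x‖) * Real.exp (-‖y‖) := by
        rw [mul_assoc (D * C), ← Real.exp_add, ← Real.exp_add]
        ring_nf

theorem Rapid.hasFDerivAt_integral {F : E × Y → ℂ} {φ : Y → ℂ} {n k : ℕ} (hF : Rapid (n + 1) F)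
    (hφ : Tame k φ) (x₀ : E) :
    HasFDerivAt (fun x => ∫ y, F (x, y) * φ y ∂μ)
      (∫ y, φ y • (fderiv ℝ F (x₀, y)).comp (ContinuousLinearMap.inl ℝ E Y) ∂μ) x₀ := by
  obtain ⟨C, A, hC, hA, hb⟩ := hF.norm_smul_fderiv_comp_inl_le hφ.bound
  have hFc := hF.continuous
  have hφc := hφ.continuous
  have hF'c : Continuous (fderiv ℝ F) := hF.contDiff.continuous_fderiv (by simp)
  have hFcont : Continuous fun y => fderiv ℝ F (x₀, y) := hF'c.comp (by fun_prop)
  refine hasFDerivAt_integral_of_dominated_of_fderiv_le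
    (F' := fun x y => φ y • (fderiv ℝ F (x, y)).comp (ContinuousLinearMap.inl ℝ E Y))
    -- On the unit ball around `x₀` the growth in the parameter is at most its value at radius ‖x₀‖
    -- + 1.
    (bound := fun y => C * Real.exp (A * (‖x₀‖ + 1)) * Real.exp (-‖y‖))
    (Metric.ball_mem_nhds x₀ one_pos)
    (Filter.Eventually.of_forall fun x => ?_) (hF.integrable_mul hφ x₀) ?_
    (Filter.Eventually.of_forall fun y x hx => ?_)
    (integrable_exp_neg_norm.const_mul _) (Filter.Eventually.of_forall fun y x hx => ?_)
  · exact (by fun_prop : Continuous fun y => F (x, y) * φ y).aestronglyMeasurable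
  · have : Continuous fun y =>
        φ y • (fderiv ℝ F (x₀, y)).comp (ContinuousLinearMap.inl ℝ E Y) :=
      hφc.smul (hFcont.clm_comp continuous_const)
    exact this.aestronglyMeasurable
  · have hx' : ‖x‖ ≤ ‖x₀‖ + 1 := by
      have h1 := norm_sub_norm_le x x₀
      rw [mem_ball_iff_norm] at hx
      linarith
    refine (hb x y).trans ?_
    gcongr
  · have h1 : HasFDerivAt (fun x => F (x, y))
        ((fderiv ℝ F (x, y)).comp (ContinuousLinearMap.inl ℝ E Y)) x :=
      (hF.1 (x, y)).hasFDerivAt.comp x (hasFDerivAt_prodMk_left x y)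
    exact h1.mul_const (φ y)

theorem Rapid.fderiv_integral {F : E × Y → ℂ} {φ : Y → ℂ} {n k : ℕ} (hF : Rapid (n + 1) F)
    (hφ : Tame k φ) (x v : E) :
    fderiv ℝ (fun x => ∫ y, F (x, y) * φ y ∂μ) x v
      = ∫ y, fderiv ℝ F (x, y) (v, 0) * φ y ∂μ := by
  obtain ⟨C, A, hC, hA, hb⟩ := hF.norm_smul_fderiv_comp_inl_le hφ.bound
  have hφc := hφ.continuous
  have hF'c : Continuous (fderiv ℝ F) := hF.contDiff.continuous_fderiv (by simp)
  have hFcont : Continuous fun y => fderiv ℝ F (x, y) := hF'c.comp (by fun_prop)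
  rw [(hF.hasFDerivAt_integral hφ x).fderiv, ContinuousLinearMap.integral_apply]
  · congr 1
    funext y
    simp [mul_comm]
  · refine (integrable_exp_neg_norm.const_mul (C * Real.exp (A * ‖x‖))).mono'
      (hφc.smul (hFcont.clm_comp continuous_const)).aestronglyMeasurable
      (Filter.Eventually.of_forall fun y => hb x y)

theorem RapidlyDecaying.expBounded_integral {F : E × Y → ℂ} {φ : Y → ℂ}
    (hF : RapidlyDecaying F) (hφ : ExpBounded φ) :
    ∃ C A : ℝ, ∀ x, ∫ y, ‖F (x, y)‖ * ‖φ y‖ ∂μ ≤ C * Real.exp (A * ‖x‖) := by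
  obtain ⟨C, A, hC, hA, h⟩ := hF.mul_bound hφ
  refine ⟨C * ∫ y, Real.exp (-‖y‖) ∂μ, A, fun x => ?_⟩
  calc ∫ y, ‖F (x, y)‖ * ‖φ y‖ ∂μ
      ≤ ∫ y, C * Real.exp (A * ‖x‖) * Real.exp (-‖y‖) ∂μ :=
        integral_mono_of_nonneg (Filter.Eventually.of_forall fun y => by positivity)
          (integrable_exp_neg_norm.const_mul _) (Filter.Eventually.of_forall fun y => h x y)
    _ = C * (∫ y, Real.exp (-‖y‖) ∂μ) * Real.exp (A * ‖x‖) := by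
        rw [integral_const_mul]; ring

/-- The regularity comes from the kernel alone: `φ` is never differentiated, and each derivative of
the integral is again an integral of a rapidly decaying kernel against `φ`. -/
theorem Rapid.tame_integral {F : E × Y → ℂ} {φ : Y → ℂ} {n k : ℕ} (hF : Rapid n F)
    (hφ : Tame k φ) : Tame n (fun x => ∫ y, F (x, y) * φ y ∂μ) := by
  have hb : ∀ G : E × Y → ℂ, RapidlyDecaying G →
      ExpBounded (fun x => ∫ y, G (x, y) * φ y ∂μ) := by
    intro G hG
    obtain ⟨C, A, h⟩ := hG.expBounded_integral (μ := μ) hφ.bound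
    refine ⟨C, A, fun x => (norm_integral_le_integral_norm _).trans ?_⟩
    simpa only [norm_mul] using h x
  induction n generalizing F with
  | zero =>
    refine ⟨?_, hb F hF.2⟩
    obtain ⟨C, A, hC, hA, h⟩ := hF.2.mul_bound hφ.bound
    have hFc := hF.continuous
    have hφc := hφ.continuous
    refine continuous_iff_continuousAt.2 fun x₀ => ?_
    refine continuousAt_of_dominated
      (bound := fun y => C * Real.exp (A * (‖x₀‖ + 1)) * Real.exp (-‖y‖))
      (Filter.Eventually.of_forall fun x =>
        (by fun_prop : Continuous fun y => F (x, y) * φ y).aestronglyMeasurable) ?_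
      (integrable_exp_neg_norm.const_mul _) (Filter.Eventually.of_forall fun y => by fun_prop)
    filter_upwards [Metric.ball_mem_nhds x₀ one_pos] with x hx
    refine Filter.Eventually.of_forall fun y => ?_
    have hx' : ‖x‖ ≤ ‖x₀‖ + 1 := by
      have h1 := norm_sub_norm_le x x₀
      rw [mem_ball_iff_norm] at hx
      linarith
    rw [norm_mul]
    refine (h x y).trans ?_
    gcongr
  | succ n ih =>
    refine ⟨fun x => (hF.hasFDerivAt_integral hφ x).differentiableAt, hb F hF.2.1, fun v => ?_⟩
    simp only [hF.fderiv_integral hφ]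
    exact ih (hF.2.2 (v, 0))

/-- Integration by parts in the second variable. -/
theorem Rapid.integral_fderiv_mul {F : E × Y → ℂ} {φ : Y → ℂ} {n k : ℕ} (hF : Rapid (n + 1) F)
    (hφ : Tame (k + 1) φ) (x : E) (v : Y) :
    ∫ y, fderiv ℝ F (x, y) (0, v) * φ y ∂μ = -∫ y, F (x, y) * fderiv ℝ φ y v ∂μ := by
  have hd : ∀ y, HasFDerivAt (fun y => F (x, y))
      ((fderiv ℝ F (x, y)).comp (ContinuousLinearMap.inr ℝ E Y)) y := fun y =>
    (hF.1 (x, y)).hasFDerivAt.comp y (hasFDerivAt_prodMk_right x y)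
  have he : ∀ y, fderiv ℝ (fun y => F (x, y)) y v = fderiv ℝ F (x, y) (0, v) := by
    intro y
    rw [(hd y).fderiv]
    simp
  have := integral_mul_fderiv_eq_neg_fderiv_mul_of_integrable (μ := μ) (v := v)
    (f := fun y => F (x, y)) (g := φ)
    (by simpa only [he] using Rapid.integrable_mul (hF.2.2 (0, v)) hφ x)
    (hF.integrable_mul (hφ.2.2 v) x) (hF.integrable_mul hφ x)
    (fun y _ => (hd y).differentiableAt) (fun y _ => hφ.1 y)
  simp only [he] at this
  rw [this, neg_neg]

end ParametricIntegral

/-! ### Exponentials of linear forms, with a logarithmic factor -/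

section ExponentialKernel

variable {W : Type*} [NormedAddCommGroup W] [NormedSpace ℝ W] {ι : Type*} [Fintype ι]

/-- The weight `e^{-α} / (e^{-α} + e^{-β})` of two linear forms. -/
def boltzmann (α β : W →L[ℝ] ℝ) (w : W) : ℝ :=
  Real.exp (-α w) / (Real.exp (-α w) + Real.exp (-β w))

/-- The exponential of a sum of a linear form, a logarithm of two exponentials and finitely
many exponentials of linear forms. -/
def expKernel (c μ : ℂ) (ℓ α β : W →L[ℝ] ℝ) (L : ι → W →L[ℝ] ℝ) (w : W) : ℂ :=
  c * Complex.exp (μ * ℓ w + 2 * μ * (Real.log (Real.exp (-α w) + Real.exp (-β w)) : ℝ)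
    - ∑ i, Complex.exp (L i w))

/-- The logarithmic derivative of `expKernel` in the direction `v`. -/
def logDerivKernel (μ : ℂ) (ℓ α β : W →L[ℝ] ℝ) (L : ι → W →L[ℝ] ℝ) (v w : W) : ℂ :=
  μ * ℓ v - 2 * μ * (boltzmann α β w * α v + (1 - boltzmann α β w) * β v)
    - ∑ i, L i v * Complex.exp (L i w)

theorem hasFDerivAt_boltzmann (α β : W →L[ℝ] ℝ) (w : W) :
    HasFDerivAt (boltzmann α β)
      ((-(boltzmann α β w * (1 - boltzmann α β w))) • (α - β)) w := by
  have hα : HasFDerivAt (fun w => Real.exp (-α w)) (Real.exp (-α w) • (-α)) w :=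
    (α.hasFDerivAt (x := w)).neg.exp
  have hβ : HasFDerivAt (fun w => Real.exp (-β w)) (Real.exp (-β w) • (-β)) w :=
    (β.hasFDerivAt (x := w)).neg.exp
  have hpos : Real.exp (-α w) + Real.exp (-β w) ≠ 0 := by positivity
  have h := hα.mul ((hasDerivAt_inv hpos).comp_hasFDerivAt w (hα.add hβ))
  refine (h.congr_of_eventuallyEq (f₁ := boltzmann α β)
    (Filter.Eventually.of_forall fun w => div_eq_mul_inv _ _)).congr_fderiv ?_
  ext v
  simp only [boltzmann, smul_apply, sub_apply, add_apply, neg_apply, smul_eq_mul,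
    Function.comp_apply, Pi.add_apply]
  field_simp
  ring

theorem boltzmann_nonneg (α β : W →L[ℝ] ℝ) (w : W) : 0 ≤ boltzmann α β w := by
  unfold boltzmann
  positivity

theorem boltzmann_le_one (α β : W →L[ℝ] ℝ) (w : W) : boltzmann α β w ≤ 1 := by
  unfold boltzmann
  rw [div_le_one (by positivity)]
  linarith [Real.exp_pos (-β w)]

theorem hasFDerivAt_ofReal_boltzmann (α β : W →L[ℝ] ℝ) (w : W) :
    HasFDerivAt (fun w => (boltzmann α β w : ℂ)) (Complex.ofRealCLM.comp
      ((-(boltzmann α β w * (1 - boltzmann α β w))) • (α - β))) w :=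
  Complex.ofRealCLM.hasFDerivAt.comp w (hasFDerivAt_boltzmann α β w)

/-- The weight p satisfies dp = -p(1 - p)(α - β), so its derivatives are polynomials in p, which
lies in [0, 1]. -/
theorem Tame.boltzmann (n : ℕ) (α β : W →L[ℝ] ℝ) :
    Tame n (fun w => (boltzmann α β w : ℂ)) := by
  have hb : ExpBounded (fun w => (TodaD.boltzmann α β w : ℂ)) := by
    refine ⟨1, 0, fun w => ?_⟩
    rw [Complex.norm_real, Real.norm_of_nonneg (boltzmann_nonneg α β w)]
    simpa using boltzmann_le_one α β w
  have hd : Differentiable ℝ (fun w => (TodaD.boltzmann α β w : ℂ)) :=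
    fun w => (hasFDerivAt_ofReal_boltzmann α β w).differentiableAt
  induction n with
  | zero => exact ⟨hd.continuous, hb⟩
  | succ n ih =>
    refine ⟨hd, hb, fun v => ?_⟩
    have : (fun w => fderiv ℝ (fun w => (TodaD.boltzmann α β w : ℂ)) w v)
        = fun w => (-(α v - β v) : ℂ)
          * ((TodaD.boltzmann α β w : ℂ) * (1 - (TodaD.boltzmann α β w : ℂ))) := by
      funext w
      rw [(hasFDerivAt_ofReal_boltzmann α β w).fderiv]
      simp
      ring
    rw [this]
    exact (ih.mul ((Tame.const n 1).sub ih)).const_mul _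

variable (c μ : ℂ) (ℓ α β : W →L[ℝ] ℝ) (L : ι → W →L[ℝ] ℝ)

theorem Tame.logDerivKernel (n : ℕ) (v : W) : Tame n (logDerivKernel μ ℓ α β L v) := by
  have h := Tame.boltzmann n α β
  refine ((Tame.const n _).sub (Tame.const_mul _ (Tame.add ?_ ?_))).sub
    (Tame.sum _ fun i _ => (Tame.cexp_clm n (L i)).const_mul _)
  · exact h.mul (Tame.const n _)
  · exact ((Tame.const n 1).sub h).mul (Tame.const n _)

theorem hasFDerivAt_log_add_exp (w : W) :
    HasFDerivAt (fun w => Real.log (Real.exp (-α w) + Real.exp (-β w)))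
      (-(boltzmann α β w • α + (1 - boltzmann α β w) • β)) w := by
  have hα : HasFDerivAt (fun w => Real.exp (-α w)) (Real.exp (-α w) • (-α)) w :=
    (α.hasFDerivAt (x := w)).neg.exp
  have hβ : HasFDerivAt (fun w => Real.exp (-β w)) (Real.exp (-β w) • (-β)) w :=
    (β.hasFDerivAt (x := w)).neg.exp
  have hpos : Real.exp (-α w) + Real.exp (-β w) ≠ 0 := by positivity
  refine ((hα.add hβ).log hpos).congr_fderiv ?_
  ext v
  simp only [boltzmann, smul_apply, add_apply,
    neg_apply, smul_eq_mul, Pi.add_apply]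
  field_simp
  ring

theorem differentiableAt_expKernel (w : W) :
    DifferentiableAt ℝ (expKernel c μ ℓ α β L) w ∧ ∀ v,
      fderiv ℝ (expKernel c μ ℓ α β L) w v
        = logDerivKernel μ ℓ α β L v w * expKernel c μ ℓ α β L w := by
  have h1 : HasFDerivAt (fun w => (ℓ w : ℂ)) (Complex.ofRealCLM.comp ℓ) w :=
    (Complex.ofRealCLM.comp ℓ).hasFDerivAt
  have h2 : HasFDerivAt
      (fun w => ((Real.log (Real.exp (-α w) + Real.exp (-β w)) : ℝ) : ℂ)) _ w :=
    Complex.ofRealCLM.hasFDerivAt.comp w (hasFDerivAt_log_add_exp α β w)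
  have h3 := HasFDerivAt.fun_sum (u := Finset.univ)
    (fun i _ => hasFDerivAt_cexp_clm (L i) w)
  have h4 := ((((h1.const_mul μ).add (h2.const_mul (2 * μ))).sub h3).cexp).const_mul c
  have h5 : HasFDerivAt (expKernel c μ ℓ α β L) _ w := h4
  refine ⟨h5.differentiableAt, fun v => ?_⟩
  rw [h5.fderiv]
  simp [expKernel, logDerivKernel]
  simp only [mul_comm (L _ v : ℂ)]
  ring

theorem differentiable_expKernel : Differentiable ℝ (expKernel c μ ℓ α β L) :=
  fun w => (differentiableAt_expKernel c μ ℓ α β L w).1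

theorem fderiv_expKernel (v w : W) :
    fderiv ℝ (expKernel c μ ℓ α β L) w v
      = logDerivKernel μ ℓ α β L v w * expKernel c μ ℓ α β L w :=
  (differentiableAt_expKernel c μ ℓ α β L w).2 v

theorem fderiv_logDerivKernel (v v' w : W) :
    fderiv ℝ (logDerivKernel μ ℓ α β L v) w v'
      = 2 * μ * (boltzmann α β w * (1 - boltzmann α β w)) * (α v - β v) * (α v' - β v')
        - ∑ i, L i v * L i v' * Complex.exp (L i w) := by
  have h1 := hasFDerivAt_ofReal_boltzmann α β w
  have h3 := HasFDerivAt.fun_sum (u := Finset.univ)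
    (fun i _ => (hasFDerivAt_cexp_clm (L i) w).const_mul (L i v : ℂ))
  have h4 := ((((h1.mul_const (α v : ℂ)).add ((h1.const_sub 1).mul_const (β v : ℂ))).const_mul
    (2 * μ)).const_sub (μ * ℓ v)).sub h3
  have h5 : HasFDerivAt (logDerivKernel μ ℓ α β L v) _ w := h4
  rw [h5.fderiv]
  simp
  simp only [mul_comm (Complex.exp _), mul_assoc]
  ring

theorem fderiv_fderiv_expKernel (v w : W) :
    fderiv ℝ (fun w => fderiv ℝ (expKernel c μ ℓ α β L) w v) w v
      = (logDerivKernel μ ℓ α β L v w ^ 2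
          + (2 * μ * (boltzmann α β w * (1 - boltzmann α β w)) * (α v - β v) ^ 2
            - ∑ i, (L i v : ℂ) ^ 2 * Complex.exp (L i w))) * expKernel c μ ℓ α β L w := by
  simp only [fderiv_expKernel]
  rw [fderiv_fun_mul ((Tame.logDerivKernel μ ℓ α β L 1 v).1 w)
    (differentiable_expKernel c μ ℓ α β L w)]
  simp only [add_apply, smul_apply, smul_eq_mul,
    fderiv_expKernel, fderiv_logDerivKernel, ← pow_two]
  ring

/-- Everything but the double exponentials grows at most exponentially: the logarithm of the sum
lies between -α(w) and log 2 + (‖α‖ + ‖β‖)‖w‖, hence grows linearly. -/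
theorem norm_expKernel_le : ∃ C A : ℝ, 0 ≤ C ∧ ∀ w, ‖expKernel c μ ℓ α β L w‖
    ≤ C * Real.exp (A * ‖w‖) * Real.exp (-∑ i, Real.exp (L i w)) := by
  refine ⟨‖c‖ * Real.exp (2 * ‖μ‖ * Real.log 2), ‖μ‖ * ‖ℓ‖ + 2 * ‖μ‖ * (‖α‖ + ‖β‖),
    by positivity, fun w => ?_⟩
  have hlog : |Real.log (Real.exp (-α w) + Real.exp (-β w))|
      ≤ Real.log 2 + (‖α‖ + ‖β‖) * ‖w‖ := by
    have ha : |α w| ≤ ‖α‖ * ‖w‖ := α.le_opNorm w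
    have hb : |β w| ≤ ‖β‖ * ‖w‖ := β.le_opNorm w
    have ha' : 0 ≤ ‖α‖ * ‖w‖ := by positivity
    have hb' : 0 ≤ ‖β‖ * ‖w‖ := by positivity
    have hl : 0 ≤ Real.log 2 := Real.log_nonneg (by norm_num)
    rw [abs_le] at ha hb ⊢
    constructor
    · have : Real.log (Real.exp (-α w)) ≤ Real.log (Real.exp (-α w) + Real.exp (-β w)) :=
        Real.log_le_log (Real.exp_pos _) (by linarith [Real.exp_pos (-β w)])
      rw [Real.log_exp] at this
      linarith
    · rw [Real.log_le_iff_le_exp (by positivity), Real.exp_add, Real.exp_log (by norm_num)]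
      have h1 : Real.exp (-α w) ≤ Real.exp ((‖α‖ + ‖β‖) * ‖w‖) := by gcongr; linarith
      have h2 : Real.exp (-β w) ≤ Real.exp ((‖α‖ + ‖β‖) * ‖w‖) := by gcongr; linarith
      linarith
  rw [expKernel, norm_mul, Complex.norm_exp, mul_assoc (‖c‖ * _), mul_assoc ‖c‖,
    ← Real.exp_add, ← Real.exp_add]
  have hsum : (∑ i, Complex.exp (L i w)).re = ∑ i, Real.exp (L i w) := by
    simp only [← Complex.ofReal_exp, Complex.re_sum, Complex.ofReal_re]
  have h1 : (μ * ℓ w).re ≤ ‖μ‖ * (‖ℓ‖ * ‖w‖) := by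
    refine (Complex.re_le_norm _).trans ?_
    rw [norm_mul, Complex.norm_real]
    gcongr
    exact ℓ.le_opNorm w
  have h2 : (2 * μ * (Real.log (Real.exp (-α w) + Real.exp (-β w)) : ℝ)).re
      ≤ 2 * ‖μ‖ * (Real.log 2 + (‖α‖ + ‖β‖) * ‖w‖) := by
    refine (Complex.re_le_norm _).trans ?_
    rw [norm_mul, norm_mul, Complex.norm_real, Complex.norm_ofNat]
    gcongr
    exact hlog
  rw [Complex.sub_re, Complex.add_re, hsum]
  gcongr
  linarith

end ExponentialKernel

section RapidExpKernel

variable {E Y : Type*} [NormedAddCommGroup E] [NormedSpace ℝ E]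
  [NormedAddCommGroup Y] [NormedSpace ℝ Y] {ι : Type*} [Fintype ι]

/-- Differentiation multiplies the kernel by a tame function, so decay of the double exponential
factor alone controls all orders. -/
theorem Rapid.expKernel (n : ℕ) (c μ : ℂ) (ℓ α β : E × Y →L[ℝ] ℝ) (L : ι → E × Y →L[ℝ] ℝ)
    (hL : RapidlyDecaying (fun w => (Real.exp (-∑ i, Real.exp (L i w)) : ℂ))) :
    Rapid n (expKernel c μ ℓ α β L) := by
  have hb : RapidlyDecaying (TodaD.expKernel c μ ℓ α β L) := by
    obtain ⟨C, A, hC, h⟩ := norm_expKernel_le c μ ℓ α β L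
    have hE : ExpBounded (fun w : E × Y => ((C * Real.exp (A * ‖w‖) : ℝ) : ℂ)) := by
      refine ⟨C, A, fun w => ?_⟩
      rw [Complex.norm_real, Real.norm_of_nonneg (by positivity)]
    intro B
    obtain ⟨D, A', h'⟩ := ExpBounded.mul_rapidlyDecaying _ _ hE hL B
    refine ⟨D, A', fun x y => (h (x, y)).trans ?_⟩
    have := h' x y
    rwa [norm_mul, Complex.norm_real, Complex.norm_real, Real.norm_of_nonneg (by positivity),
      Real.norm_of_nonneg (by positivity)] at this
  induction n with
  | zero => exact ⟨(differentiable_expKernel c μ ℓ α β L).continuous, hb⟩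
  | succ n ih =>
    refine ⟨differentiable_expKernel c μ ℓ α β L, hb, fun v => ?_⟩
    simp only [fderiv_expKernel]
    exact (Tame.logDerivKernel μ ℓ α β L n v).mul_rapid ih

end RapidExpKernel

/-! ### The recursive kernel in real coordinates, and its decay -/

section TodaForms

/-- The coordinates `(x, (x', t))` of the integrand of the recursive kernel. -/
abbrev Coords (r : ℕ) : Type :=
  (Fin (r + 2) → ℝ) × ((Fin (r + 1) → ℝ) × (Fin (r + 1) → ℝ))

variable (r : ℕ)

/-- The coordinate `x_j`. -/
def xForm (j : Fin (r + 2)) : Coords r →L[ℝ] ℝ :=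
  (ContinuousLinearMap.proj j).comp (ContinuousLinearMap.fst ℝ _ _)

/-- The coordinate `x'_i`. -/
def uForm (i : Fin (r + 1)) : Coords r →L[ℝ] ℝ :=
  (ContinuousLinearMap.proj i).comp
    ((ContinuousLinearMap.fst ℝ _ _).comp (ContinuousLinearMap.snd ℝ _ _))

/-- The coordinate `t_i`. -/
def tForm (i : Fin (r + 1)) : Coords r →L[ℝ] ℝ :=
  (ContinuousLinearMap.proj i).comp
    ((ContinuousLinearMap.snd ℝ _ _).comp (ContinuousLinearMap.snd ℝ _ _))

@[simp] theorem xForm_apply (j : Fin (r + 2)) (w : Coords r) : xForm r j w = w.1 j := rfl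

@[simp] theorem uForm_apply (i : Fin (r + 1)) (w : Coords r) : uForm r i w = w.2.1 i := rfl

@[simp] theorem tForm_apply (i : Fin (r + 1)) (w : Coords r) : tForm r i w = w.2.2 i := rfl

/-- The exponential terms in the exponent of the recursive kernel. -/
inductive Term (r : ℕ) : Type
  | a (i : Fin (r + 1))
  | b (i : Fin (r + 1))
  | c
  | d (i : Fin (r + 1))
  | g (i : Fin r)
  | h

/-- The terms as a sum type. -/
def termEquiv : Term r ≃ (Fin (r + 1) ⊕ Fin (r + 1)) ⊕ (Fin (r + 1) ⊕ Fin r) ⊕ (Unit ⊕ Unit) where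
  toFun
    | .a i => .inl (.inl i)
    | .b i => .inl (.inr i)
    | .d i => .inr (.inl (.inl i))
    | .g i => .inr (.inl (.inr i))
    | .c => .inr (.inr (.inl ()))
    | .h => .inr (.inr (.inr ()))
  invFun
    | .inl (.inl i) => .a i
    | .inl (.inr i) => .b i
    | .inr (.inl (.inl i)) => .d i
    | .inr (.inl (.inr i)) => .g i
    | .inr (.inr (.inl _)) => .c
    | .inr (.inr (.inr _)) => .h
  left_inv := by rintro (_ | _ | _ | _ | _ | _) <;> rfl
  right_inv := by rintro ((_ | _) | (_ | _) | (_ | _)) <;> rfl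

instance : Fintype (Term r) := Fintype.ofEquiv _ (termEquiv r).symm

theorem sum_term {M : Type*} [AddCommMonoid M] (f : Term r → M) :
    ∑ e, f e = (∑ i, f (.a i) + ∑ i, f (.b i)) + ((∑ i, f (.d i) + ∑ i, f (.g i))
      + (f .c + f .h)) := by
  rw [← Equiv.sum_comp (termEquiv r).symm f, Fintype.sum_sum_type, Fintype.sum_sum_type,
    Fintype.sum_sum_type, Fintype.sum_sum_type, Fintype.sum_sum_type]
  simp [termEquiv]

/-- The linear forms in the exponents of the exponential terms. -/
def termForm : Term r → Coords r →L[ℝ] ℝ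
  | .a i => tForm r i - xForm r i.castSucc
  | .b i => xForm r i.succ - tForm r i
  | .c => -xForm r (Fin.last (r + 1)) - tForm r (Fin.last r)
  | .d i => uForm r i - tForm r i
  | .g i => tForm r i.succ - uForm r i.castSucc
  | .h => -uForm r (Fin.last r) - tForm r (Fin.last r)

/-- The linear form `∑ x_j + ∑ x'_i - 2 ∑ t_i`. -/
def sumForm : Coords r →L[ℝ] ℝ :=
  ∑ j, xForm r j + ∑ i, uForm r i - (2 : ℝ) • ∑ i, tForm r i

/-- The integrand of the recursive kernel as a function of all its variables. -/
def todaKernel (lam : ℂ) : Coords r → ℂ :=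
  expKernel (Complex.exp (2 * Real.pi * (r + 1) * lam)) (Complex.I * lam) (sumForm r)
    (xForm r (Fin.last (r + 1))) (uForm r (Fin.last r)) (termForm r)

theorem exp_sub_pi_I (z : ℂ) : Complex.exp (z - Real.pi * Complex.I) = -Complex.exp z := by
  rw [Complex.exp_sub, Complex.exp_pi_mul_I]
  ring

/-- The shift by iπ turns each exponential into its negative. In the linear phase it contributes
-2iλ · (r + 1)iπ = 2π(r + 1)λ, which is the constant in `todaKernel`. -/
theorem recIntegrand_eq_todaKernel (lam : ℂ) (x : Fin (r + 2) → ℝ) (x' t : Fin (r + 1) → ℝ) :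
    recIntegrand r lam x x' t = todaKernel r lam (x, (x', t)) := by
  have hS : (0 : ℝ) < Real.exp (-x (Fin.last (r + 1))) + Real.exp (-x' (Fin.last r)) := by
    positivity
  have h1 : ∀ z w : ℂ, Complex.exp (z + Real.pi * Complex.I - w) = -Complex.exp (z - w) := by
    intro z w
    rw [show z + Real.pi * Complex.I - w = (z - w) + Real.pi * Complex.I by ring,
      Complex.exp_add, Complex.exp_pi_mul_I]
    ring
  have h2 : ∀ z w : ℂ, Complex.exp (w - (z + Real.pi * Complex.I)) = -Complex.exp (w - z) := by
    intro z w
    rw [← sub_sub, exp_sub_pi_I]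
  rw [recIntegrand, todaKernel, expKernel, kernelDC, kernelCD,
    Complex.cpow_def_of_ne_zero (by exact_mod_cast hS.ne'), ← Complex.ofReal_log hS.le,
    ← Complex.exp_add, ← Complex.exp_add, ← Complex.exp_add, ← Complex.exp_add]
  congr 1
  simp only [zContour, h1, h2, sum_term, termForm, sumForm]
  -- `kernelCD` lists the last term of type `d` apart from the others.
  rw [Fin.sum_univ_castSucc (fun i => Complex.exp (((uForm r i - tForm r i) _ : ℝ) : ℂ))]
  simp [Finset.sum_add_distrib, Finset.sum_neg_distrib]
  ring_nf
  simp

/-- Interlacing: `a` and `b` trap each t_i between coordinates of x up to S. Then `d` bounds x'_i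
above by t_i, and `g` bounds it below by t_{i+1}; at the last site `h` takes the place of `g`. -/
theorem termForm_bound (x : Fin (r + 2) → ℝ) (u t : Fin (r + 1) → ℝ) (S : ℝ) (hS : 0 ≤ S)
    (h : ∀ e, termForm r e (x, (u, t)) ≤ S) : ‖(u, t)‖ ≤ ‖x‖ + 2 * S := by
  have hx : ∀ j, |x j| ≤ ‖x‖ := fun j => norm_le_pi_norm x j
  have ht : ∀ i, |t i| ≤ ‖x‖ + S := by
    intro i
    have h1 := h (.a i)
    have h2 := h (.b i)
    simp [termForm] at h1 h2
    have h3 := abs_le.1 (hx i.castSucc)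
    have h4 := abs_le.1 (hx i.succ)
    rw [abs_le]
    constructor <;> linarith
  have hu : ∀ i, |u i| ≤ ‖x‖ + 2 * S := by
    intro i
    have h1 := h (.d i)
    simp [termForm] at h1
    have h2 := abs_le.1 (ht i)
    rw [abs_le]
    refine ⟨?_, by linarith⟩
    induction i using Fin.lastCases with
    | last =>
      have h3 := h .h
      simp [termForm] at h3
      linarith
    | cast i =>
      have h3 := h (.g i)
      simp [termForm] at h3
      have h4 := abs_le.1 (ht i.succ)
      linarith
  rw [Prod.norm_mk]
  have hn : 0 ≤ ‖x‖ + 2 * S := by positivity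
  refine max_le ((pi_norm_le_iff_of_nonneg hn).2 hu) ((pi_norm_le_iff_of_nonneg hn).2 fun i => ?_)
  exact (ht i).trans (by linarith)

theorem rapidlyDecaying_exp_neg_terms :
    RapidlyDecaying
      (fun w : Coords r => (Real.exp (-∑ e, Real.exp (termForm r e w)) : ℂ)) := by
  intro B
  obtain ⟨n, hn⟩ := exists_nat_ge B
  refine ⟨(2 * n).factorial * Real.exp 1, n, fun x y => ?_⟩
  set V := ∑ e, Real.exp (termForm r e (x, y)) with hV
  have hV0 : 0 ≤ V := Finset.sum_nonneg fun e _ => (Real.exp_pos _).le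
  -- Each term is at most V, so each form is at most log(1 + V). Thus e^{n‖y‖} is at most e^{n‖x‖}
  -- times the polynomial (1 + V)^{2n}, which e^{-V} dominates.
  have hy : ‖y‖ ≤ ‖x‖ + 2 * Real.log (1 + V) := by
    refine termForm_bound r x y.1 y.2 _ (Real.log_nonneg (by linarith)) fun e => ?_
    rw [Real.le_log_iff_exp_le (by linarith)]
    have : Real.exp (termForm r e (x, y)) ≤ V :=
      Finset.single_le_sum (f := fun e => Real.exp (termForm r e (x, y)))
        (fun e _ => (Real.exp_pos _).le) (Finset.mem_univ e)
    exact this.trans (by linarith)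
  have h1 : Real.exp (n * ‖y‖) ≤ Real.exp (n * ‖x‖) * (1 + V) ^ (2 * n) := by
    have : (1 + V) ^ (2 * n) = Real.exp (n * (2 * Real.log (1 + V))) := by
      rw [← Real.exp_log (by linarith : 0 < 1 + V), ← Real.exp_nat_mul, Real.log_exp]
      push_cast
      ring_nf
    rw [this, ← Real.exp_add, ← mul_add]
    gcongr
  have h2 := one_add_pow_le_exp hV0 (2 * n)
  have h3 : Real.exp (B * ‖y‖) ≤ Real.exp (n * ‖y‖) := by gcongr
  change ‖((Real.exp (-V) : ℝ) : ℂ)‖ ≤ _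
  rw [Complex.norm_real, Real.norm_of_nonneg (Real.exp_pos _).le, Real.exp_sub, mul_div_assoc', le_div_iff₀ (Real.exp_pos _)]
  calc Real.exp (-V) * Real.exp (B * ‖y‖)
      ≤ Real.exp (-V) * (Real.exp (n * ‖x‖) * ((2 * n).factorial * Real.exp (1 + V))) := by
        gcongr
        exact h3.trans (h1.trans (by gcongr))
    _ = (2 * n).factorial * (Real.exp (-V) * Real.exp (1 + V)) * Real.exp (n * ‖x‖) := by ring
    _ = (2 * n).factorial * Real.exp 1 * Real.exp (n * ‖x‖) := by
        rw [← Real.exp_add]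
        ring_nf

theorem rapid_todaKernel (n : ℕ) (lam : ℂ) : Rapid n (todaKernel r lam) :=
  Rapid.expKernel n _ _ _ _ _ _ (rapidlyDecaying_exp_neg_terms r)

end TodaForms

/-! ### The intertwining relation of the two Hamiltonians -/

section Intertwining

variable (r : ℕ)

/-- The unit vector of the coordinate `x_j`. -/
def xDir (j : Fin (r + 2)) : Coords r := (Pi.single j 1, 0)

/-- The unit vector of the coordinate `x'_i`. -/
def uDir (i : Fin (r + 1)) : Coords r := (0, (Pi.single i 1, 0))

/-- The unit vector of the coordinate `t_i`. -/
def tDir (i : Fin (r + 1)) : Coords r := (0, (0, Pi.single i 1))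

variable {r} (φ : ℝ → ℂ) (e : Term r → ℂ)

theorem apply_neg_ite_one_zero (hφ : φ 0 = 0) (P : Prop) [Decidable P] :
    φ (-if P then 1 else 0) = if P then φ (-1) else 0 := by
  split_ifs <;> simp [hφ]

/-- This lemma and the next ones list the terms that contain a given coordinate. The function φ
stands for both s ↦ s and s ↦ s², the weights in first and second derivatives. -/
theorem sum_term_xDir_zero (hφ : φ 0 = 0) :
    ∑ k, φ (termForm r k (xDir r 0)) * e k = φ (-1) * e (.a 0) := by
  have h : ∀ i : Fin (r + 1), (i.castSucc = 0) ↔ i = 0 := fun i => Fin.castSucc_eq_zero_iff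
  simp [sum_term, termForm, xDir, Pi.single_apply, hφ, ite_mul, h,
    Fin.last_eq_zero_iff, Fin.succ_ne_zero, apply_neg_ite_one_zero φ hφ]

theorem sum_term_xDir_mid (hφ : φ 0 = 0) (j : Fin r) :
    ∑ k, φ (termForm r k (xDir r j.succ.castSucc)) * e k
      = φ (-1) * e (.a j.succ) + φ 1 * e (.b j.castSucc) := by
  have h : ∀ i : Fin (r + 1), (i.castSucc = j.castSucc.succ) ↔ i = j.succ := fun i => by
    rw [Fin.succ_castSucc, Fin.castSucc_inj]
  simp [sum_term, termForm, xDir, Pi.single_apply, hφ, apply_ite φ, ite_mul, h,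
    apply_neg_ite_one_zero φ hφ]

theorem sum_term_xDir_last (hφ : φ 0 = 0) :
    ∑ k, φ (termForm r k (xDir r (Fin.last (r + 1)))) * e k
      = φ 1 * e (.b (Fin.last r)) + φ (-1) * e .c := by
  have h : ∀ i : Fin (r + 1), (i.succ = Fin.last (r + 1)) ↔ i = Fin.last r := fun i => by
    rw [← Fin.succ_last, Fin.succ_inj]
  simp [sum_term, termForm, xDir, Pi.single_apply, hφ, apply_ite φ, ite_mul, h,
    Fin.castSucc_ne_last]

theorem sum_term_uDir_mid (hφ : φ 0 = 0) (j : Fin r) :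
    ∑ k, φ (termForm r k (uDir r j.castSucc)) * e k
      = φ 1 * e (.d j.castSucc) + φ (-1) * e (.g j) := by
  have h' : Fin.last r ≠ j.castSucc := (Fin.castSucc_ne_last _).symm
  simp [sum_term, termForm, uDir, Pi.single_apply, hφ, apply_ite φ, ite_mul, h',
    apply_neg_ite_one_zero φ hφ]

theorem sum_term_uDir_last (hφ : φ 0 = 0) :
    ∑ k, φ (termForm r k (uDir r (Fin.last r))) * e k
      = φ 1 * e (.d (Fin.last r)) + φ (-1) * e .h := by
  simp [sum_term, termForm, uDir, Pi.single_apply, hφ, apply_ite φ, ite_mul,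
    Fin.castSucc_ne_last]

theorem sum_term_tDir (hφ : φ 0 = 0) (i : Fin (r + 1)) :
    ∑ k, φ (termForm r k (tDir r i)) * e k
      = φ 1 * e (.a i) + φ (-1) * e (.b i) + φ (-1) * e (.d i)
        -- The term `g j` contains t_{j+1}, so the first t-coordinate has none; `Fin.cons 0` encodes
        -- this.
        + φ 1 * (Fin.cons 0 (fun j => e (.g j)) : Fin (r + 1) → ℂ) i
        + if i = Fin.last r then φ (-1) * e .c + φ (-1) * e .h else 0 := by
  have hg : ∑ j : Fin r, φ (if j.succ = i then 1 else 0) * e (.g j)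
      = φ 1 * (Fin.cons 0 (fun j => e (.g j)) : Fin (r + 1) → ℂ) i := by
    induction i using Fin.cases with
    | zero => simp [Fin.succ_ne_zero, hφ]
    | succ i => simp [apply_ite φ, hφ, ite_mul]
  have hl : (Fin.last r = i) ↔ i = Fin.last r := eq_comm
  by_cases h : i = Fin.last r
  · subst h
    simp [sum_term, termForm, tDir, Pi.single_apply, hφ, apply_ite φ, ite_mul, ← hg,
      apply_neg_ite_one_zero φ hφ]
    ring
  · simp [sum_term, termForm, tDir, Pi.single_apply, hφ, apply_ite φ, ite_mul, ← hg,
      apply_neg_ite_one_zero φ hφ, hl, h]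
    ring

/-- The algebraic identity behind the intertwining relation of the Hamiltonians of types
`D_{r+2}` and `D_{r+1}`. -/
theorem toda_identity (μ p c h : ℂ) (a b d : Fin (r + 1) → ℂ) (g : Fin r → ℂ)
    (hag : ∀ j, a j.succ * b j.castSucc = g j * d j.castSucc)
    (hcb : c * b (Fin.last r) = h * d (Fin.last r))
    (hpc : (1 - p) * c = p * h) (hpb : p * b (Fin.last r) = (1 - p) * d (Fin.last r)) :
    -(1 / 2) * ((μ + a 0) ^ 2 + ∑ j : Fin r, (μ + a j.succ - b j.castSucc) ^ 2
          + (μ - 2 * μ * p - b (Fin.last r) + c) ^ 2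
        + (2 * μ * (p * (1 - p)) - (a 0 + ∑ j : Fin r, (a j.succ + b j.castSucc)
          + (b (Fin.last r) + c))))
      + (∑ i, a i * b i + a (Fin.last r) * c)
    = -(1 / 2) * (∑ j : Fin r, (μ - d j.castSucc + g j) ^ 2
          + (μ - 2 * μ * (1 - p) - d (Fin.last r) + h) ^ 2
        + (2 * μ * (p * (1 - p)) - (∑ j : Fin r, (d j.castSucc + g j) + (d (Fin.last r) + h))))
      + (∑ j : Fin r, g j * d j.succ + (Fin.cons 0 g : Fin (r + 1) → ℂ) (Fin.last r) * h)
      - μ ^ 2 / 2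
      + ∑ i : Fin (r + 1), ((1 / 2) * (a i + b i - d i - (Fin.cons 0 g : Fin (r + 1) → ℂ) i
            + if i = Fin.last r then c - h else 0)
          + (1 / 2) * (a i - b i + d i - (Fin.cons 0 g : Fin (r + 1) → ℂ) i
              + if i = Fin.last r then h - c else 0)
            * (-2 * μ - a i + b i + d i - (Fin.cons 0 g : Fin (r + 1) → ℂ) i
              + if i = Fin.last r then c + h else 0)) := by
  set G : Fin (r + 1) → ℂ := Fin.cons 0 g with hG
  have hG1 : ∑ i, G i = ∑ j, g j := by simp [hG, Fin.sum_univ_succ]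
  have hG2 : ∑ i, G i ^ 2 = ∑ j, g j ^ 2 := by simp [hG, Fin.sum_univ_succ]
  have hGd : ∑ i, d i * G i = ∑ j, g j * d j.succ := by
    simp [hG, Fin.sum_univ_succ, mul_comm]
  have ht : ∀ i : Fin (r + 1), ((1 / 2) * (a i + b i - d i - G i
            + if i = Fin.last r then c - h else 0)
          + (1 / 2) * (a i - b i + d i - G i + if i = Fin.last r then h - c else 0)
            * (-2 * μ - a i + b i + d i - G i + if i = Fin.last r then c + h else 0))
      = (1 / 2) * (a i + b i - d i - G i) - μ * (a i - b i + d i - G i)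
        + (1 / 2) * (d i ^ 2 + G i ^ 2 - a i ^ 2 - b i ^ 2) - d i * G i + a i * b i
        + if i = Fin.last r then ((1 / 2) * (c - h)
          + (1 / 2) * ((h - c) * (-2 * μ - a (Fin.last r) + b (Fin.last r) + d (Fin.last r)
              - G (Fin.last r) + (c + h))
            + (a (Fin.last r) - b (Fin.last r) + d (Fin.last r) - G (Fin.last r)) * (c + h)))
          else 0 := by
    intro i
    split_ifs with hi
    · subst hi
      ring
    · ring
  -- By `hag` the mixed products on the x side become those on the x' side, where they cancel.
  have hx : ∑ j : Fin r, (μ + a j.succ - b j.castSucc) ^ 2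
      = ∑ j : Fin r, (μ ^ 2 + 2 * μ * (a j.succ - b j.castSucc) + a j.succ ^ 2
        + b j.castSucc ^ 2 - 2 * (g j * d j.castSucc)) :=
    Finset.sum_congr rfl fun j _ => by rw [← hag]; ring
  have hu : ∑ j : Fin r, (μ - d j.castSucc + g j) ^ 2
      = ∑ j : Fin r, (μ ^ 2 + 2 * μ * (g j - d j.castSucc) + d j.castSucc ^ 2
        + g j ^ 2 - 2 * (g j * d j.castSucc)) :=
    Finset.sum_congr rfl fun j _ => by ring
  rw [hx, hu, Finset.sum_congr rfl fun i _ => ht i]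
  simp only [Finset.sum_add_distrib, Finset.sum_sub_distrib, ← Finset.mul_sum,
    Finset.sum_ite_eq', Finset.mem_univ, if_true, hG1, hG2, hGd]
  have ha1 := Fin.sum_univ_succ a
  have ha2 := Fin.sum_univ_succ fun i => a i ^ 2
  have hb1 := Fin.sum_univ_castSucc b
  have hb2 := Fin.sum_univ_castSucc fun i => b i ^ 2
  have hd1 := Fin.sum_univ_castSucc d
  have hd2 := Fin.sum_univ_castSucc fun i => d i ^ 2
  rw [ha1, ha2, hb1, hb2, hd1, hd2]
  -- What is left sits at the last site. The relations `hpc` and `hpb` remove the terms linear in μ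
  -- that come from the logarithmic factor, and `hcb` the mixed product.
  linear_combination 2 * hcb - 2 * μ * hpc - 2 * μ * hpb

end Intertwining

/-- The potential of the open Toda chain of type `D_{m+1}`. -/
def potential (m : ℕ) (x : Fin (m + 1) → ℝ) : ℝ :=
  (∑ j : Fin m, Real.exp (x j.succ - x j.castSucc)) + boundaryPotential m x

section Intertwining

variable (r : ℕ)

theorem sumForm_xDir (j : Fin (r + 2)) : sumForm r (xDir r j) = 1 := by
  simp [sumForm, xDir]

theorem sumForm_uDir (i : Fin (r + 1)) : sumForm r (uDir r i) = 1 := by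
  simp [sumForm, uDir]

theorem sumForm_tDir (i : Fin (r + 1)) : sumForm r (tDir r i) = -2 := by
  simp [sumForm, tDir]

/-- The sign of a term: `1` for the terms coupling to `x`, `-1` for those coupling to `x'`. -/
def termSign : Term r → ℂ
  | .a _ => 1
  | .b _ => 1
  | .c => 1
  | .d _ => -1
  | .g _ => -1
  | .h => -1

/-- The coefficient of the kernel in the total derivative of the intertwining relation. -/
def flux (i : Fin (r + 1)) (w : Coords r) : ℂ :=
  (1 / 2) * ∑ k, termForm r k (tDir r i) * termSign r k * Complex.exp (termForm r k w)

theorem tame_flux (n : ℕ) (i : Fin (r + 1)) : Tame n (flux r i) :=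
  (Tame.sum _ fun k _ => (Tame.cexp_clm n (termForm r k)).const_mul _).const_mul _

theorem fderiv_flux (i : Fin (r + 1)) (w : Coords r) :
    fderiv ℝ (flux r i) w (tDir r i)
      = (1 / 2) * ∑ k, (termForm r k (tDir r i) : ℂ) ^ 2
          * (termSign r k * Complex.exp (termForm r k w)) := by
  have h := (HasFDerivAt.fun_sum (u := Finset.univ) (fun k _ =>
    (hasFDerivAt_cexp_clm (termForm r k) w).const_mul
      ((termForm r k (tDir r i) : ℂ) * termSign r k))).const_mul (1 / 2 : ℂ)
  have h' : HasFDerivAt (flux r i) _ w := h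
  rw [h'.fderiv]
  simp only [smul_apply, sum_apply, smul_eq_mul,
    ContinuousLinearMap.comp_apply, Complex.ofRealCLM_apply]
  congr 1
  refine Finset.sum_congr rfl fun k _ => ?_
  ring

variable {r}

theorem one_sub_boltzmann_mul_exp {W : Type*} [NormedAddCommGroup W] [NormedSpace ℝ W]
    (α β : W →L[ℝ] ℝ) (w : W) (s : ℝ) :
    (1 - boltzmann α β w) * Real.exp (-α w + s) = boltzmann α β w * Real.exp (-β w + s) := by
  rw [boltzmann, Real.exp_add, Real.exp_add]
  field_simp
  ring

theorem boltzmann_mul_exp {W : Type*} [NormedAddCommGroup W] [NormedSpace ℝ W]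
    (α β : W →L[ℝ] ℝ) (w : W) (s : ℝ) :
    boltzmann α β w * Real.exp (α w + s) = (1 - boltzmann α β w) * Real.exp (β w + s) := by
  rw [boltzmann, Real.exp_add, Real.exp_add, Real.exp_neg, Real.exp_neg]
  field_simp
  ring

/-- The intertwining relation of the Hamiltonians of types `D_{r+2}` and `D_{r+1}` for the
integrand of the recursive kernel, up to a total derivative. -/
theorem todaKernel_intertwining (lam : ℂ) (w : Coords r) :
    -(1 / 2 : ℂ) * (∑ j, fderiv ℝ (fun w => fderiv ℝ (todaKernel r lam) w (xDir r j)) w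
          (xDir r j)) + potential (r + 1) w.1 * todaKernel r lam w
      = -(1 / 2 : ℂ) * (∑ i, fderiv ℝ (fun w => fderiv ℝ (todaKernel r lam) w (uDir r i)) w
            (uDir r i)) + potential r w.2.1 * todaKernel r lam w
        + lam ^ 2 / 2 * todaKernel r lam w
        + ∑ i, fderiv ℝ (fun w => flux r i w * todaKernel r lam w) w (tDir r i) := by
  have hd : ∀ w, DifferentiableAt ℝ (todaKernel r lam) w := (rapid_todaKernel r 1 lam).1
  have hflux : ∀ i, fderiv ℝ (fun w => flux r i w * todaKernel r lam w) w (tDir r i)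
      = (fderiv ℝ (flux r i) w (tDir r i) + flux r i w * logDerivKernel (Complex.I * lam)
        (sumForm r) (xForm r (Fin.last (r + 1))) (uForm r (Fin.last r)) (termForm r) (tDir r i) w)
          * todaKernel r lam w := by
    intro i
    rw [fderiv_fun_mul ((tame_flux r 1 i).1 w) (hd w)]
    simp only [todaKernel, add_apply, smul_apply, smul_eq_mul, fderiv_expKernel]
    ring
  simp only [hflux, fderiv_flux]
  simp only [todaKernel, fderiv_fderiv_expKernel, ← Finset.sum_mul]
  generalize expKernel (Complex.exp (2 * Real.pi * (r + 1) * lam)) (Complex.I * lam) (sumForm r)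
    (xForm r (Fin.last (r + 1))) (uForm r (Fin.last r)) (termForm r) w = K
  set p : ℂ := (boltzmann (xForm r (Fin.last (r + 1))) (uForm r (Fin.last r)) w : ℂ) with hp
  have h1 : ((fun s : ℝ => (s : ℂ)) 0) = 0 := by simp
  have h2 : ((fun s : ℝ => (s : ℂ) ^ 2) 0) = 0 := by simp
  set e : Term r → ℂ := fun k => Complex.exp (termForm r k w) with he
  -- The potentials are products of neighbouring terms in which t cancels.
  have hpx : (potential (r + 1) w.1 : ℂ)
      = ∑ i, e (.a i) * e (.b i) + e (.a (Fin.last r)) * e .c := by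
    simp only [potential, boundaryPotential, he, ← Complex.exp_add, termForm]
    push_cast
    simp
  have hpu : (potential r w.2.1 : ℂ) = ∑ j : Fin r, e (.g j) * e (.d j.succ)
      + (Fin.cons 0 (fun j => e (.g j)) : Fin (r + 1) → ℂ) (Fin.last r) * e .h := by
    -- For r = 0 there is no `g`: the entry of `Fin.cons` is 0, matching the absent potential in
    -- rank one.
    have hb : ((boundaryPotential r w.2.1 : ℝ) : ℂ)
        = (Fin.cons 0 (fun j => e (.g j)) : Fin (r + 1) → ℂ) (Fin.last r) * e .h := by
      cases r with
      | zero => simp [boundaryPotential]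
      | succ r =>
        rw [← Fin.succ_last, Fin.cons_succ]
        simp only [boundaryPotential, he, ← Complex.exp_add, termForm]
        push_cast
        simp
    rw [potential, Complex.ofReal_add, hb]
    congr 1
    simp only [he, ← Complex.exp_add, termForm]
    push_cast
    simp
  have key := toda_identity (Complex.I * lam) p (e .c) (e .h) (fun i => e (.a i))
    (fun i => e (.b i)) (fun i => e (.d i)) (fun j => e (.g j))
    (by
      intro j
      simp only [he, ← Complex.exp_add, termForm]
      simp)
    (by
      simp only [he, ← Complex.exp_add, termForm]
      simp
      ring_nf)
    (by
      have := one_sub_boltzmann_mul_exp (xForm r (Fin.last (r + 1))) (uForm r (Fin.last r)) w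
        (-w.2.2 (Fin.last r))
      simp only [he, hp, termForm]
      exact_mod_cast this)
    (by
      have := boltzmann_mul_exp (xForm r (Fin.last (r + 1))) (uForm r (Fin.last r)) w
        (-w.2.2 (Fin.last r))
      simp only [he, hp, termForm, Fin.succ_last]
      exact_mod_cast this)
  have hlast : ∀ j : Fin (r + 1), Fin.last (r + 1) ≠ j.castSucc :=
    fun j => (Fin.castSucc_ne_last j).symm
  have hlast' : ∀ j : Fin r, Fin.last r ≠ j.castSucc := fun j => (Fin.castSucc_ne_last j).symm
  have xl : ∀ j, xForm r (Fin.last (r + 1)) (xDir r (Fin.castSucc j)) = 0 := fun j => by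
    simp [xDir, hlast j]
  have xl' : xForm r (Fin.last (r + 1)) (xDir r (Fin.last (r + 1))) = 1 := by simp [xDir]
  have ux : ∀ j, uForm r (Fin.last r) (xDir r j) = 0 := fun j => by simp [xDir]
  have xu : ∀ i, xForm r (Fin.last (r + 1)) (uDir r i) = 0 := fun i => by simp [uDir]
  have ul : ∀ j, uForm r (Fin.last r) (uDir r (Fin.castSucc j)) = 0 := fun j => by
    simp [uDir, hlast' j]
  have ul' : uForm r (Fin.last r) (uDir r (Fin.last r)) = 1 := by simp [uDir]
  have xt : ∀ i, xForm r (Fin.last (r + 1)) (tDir r i) = 0 := fun i => by simp [tDir]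
  have ut : ∀ i, uForm r (Fin.last r) (tDir r i) = 0 := fun i => by simp [tDir]
  have x00 := xl 0
  rw [Fin.castSucc_zero] at x00
  have sx0 := sum_term_xDir_zero (fun s : ℝ => (s : ℂ)) e h1
  have sx0' := sum_term_xDir_zero (fun s : ℝ => (s : ℂ) ^ 2) e h2
  have sxm := sum_term_xDir_mid (fun s : ℝ => (s : ℂ)) e h1
  have sxm' := sum_term_xDir_mid (fun s : ℝ => (s : ℂ) ^ 2) e h2
  have sxl := sum_term_xDir_last (fun s : ℝ => (s : ℂ)) e h1
  have sxl' := sum_term_xDir_last (fun s : ℝ => (s : ℂ) ^ 2) e h2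
  have sums := sum_term_uDir_mid (fun s : ℝ => (s : ℂ)) e h1
  have sums' := sum_term_uDir_mid (fun s : ℝ => (s : ℂ) ^ 2) e h2
  have sul := sum_term_uDir_last (fun s : ℝ => (s : ℂ)) e h1
  have sul' := sum_term_uDir_last (fun s : ℝ => (s : ℂ) ^ 2) e h2
  have st := sum_term_tDir (fun s : ℝ => (s : ℂ)) e h1
  have st1 := sum_term_tDir (fun s : ℝ => (s : ℂ)) (fun k => termSign r k * e k) h1
  have st2 := sum_term_tDir (fun s : ℝ => (s : ℂ) ^ 2) (fun k => termSign r k * e k) h2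
  have hcons : ∀ i, (Fin.cons 0 (fun j => termSign r (.g j) * e (.g j)) : Fin (r + 1) → ℂ) i
      = -(Fin.cons 0 (fun j => e (.g j)) : Fin (r + 1) → ℂ) i := by
    intro i
    induction i using Fin.cases with
    | zero => simp
    | succ i => simp [termSign]
  simp only [he] at sx0 sx0' sxm sxm' sxl sxl' sums sums' sul sul' st st1 st2 hcons
  have hX : ∑ j, (logDerivKernel (Complex.I * lam) (sumForm r) (xForm r (Fin.last (r + 1)))
        (uForm r (Fin.last r)) (termForm r) (xDir r j) w ^ 2
      + (2 * (Complex.I * lam) * (p * (1 - p)) * (xForm r (Fin.last (r + 1)) (xDir r j)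
          - uForm r (Fin.last r) (xDir r j)) ^ 2
        - ∑ k, (termForm r k (xDir r j) : ℂ) ^ 2 * Complex.exp (termForm r k w)))
      = (Complex.I * lam + e (.a 0)) ^ 2
        + ∑ j : Fin r, (Complex.I * lam + e (.a j.succ) - e (.b j.castSucc)) ^ 2
        + (Complex.I * lam - 2 * (Complex.I * lam) * p - e (.b (Fin.last r)) + e .c) ^ 2
        + (2 * (Complex.I * lam) * (p * (1 - p)) - (e (.a 0)
          + ∑ j : Fin r, (e (.a j.succ) + e (.b j.castSucc))
          + (e (.b (Fin.last r)) + e .c))) := by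
    rw [Fin.sum_univ_castSucc, Fin.sum_univ_succ]
    simp only [logDerivKernel, sx0, sx0', sxm, sxm', sxl, sxl', Fin.castSucc_zero, x00, xl, xl',
      ux, sumForm_xDir, ← hp, he]
    push_cast
    simp only [← add_sub_assoc, Finset.sum_add_distrib, Finset.sum_sub_distrib]
    ring_nf
    simp only [Finset.sum_const_zero, add_zero]
  have hU : ∑ i, (logDerivKernel (Complex.I * lam) (sumForm r) (xForm r (Fin.last (r + 1)))
        (uForm r (Fin.last r)) (termForm r) (uDir r i) w ^ 2
      + (2 * (Complex.I * lam) * (p * (1 - p)) * (xForm r (Fin.last (r + 1)) (uDir r i)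
          - uForm r (Fin.last r) (uDir r i)) ^ 2
        - ∑ k, (termForm r k (uDir r i) : ℂ) ^ 2 * Complex.exp (termForm r k w)))
      = ∑ j : Fin r, (Complex.I * lam - e (.d j.castSucc) + e (.g j)) ^ 2
        + (Complex.I * lam - 2 * (Complex.I * lam) * (1 - p) - e (.d (Fin.last r)) + e .h) ^ 2
        + (2 * (Complex.I * lam) * (p * (1 - p)) - (∑ j : Fin r, (e (.d j.castSucc) + e (.g j))
          + (e (.d (Fin.last r)) + e .h))) := by
    rw [Fin.sum_univ_castSucc]
    simp only [logDerivKernel, sums, sums', sul, sul', xu, ul, ul', sumForm_uDir, ← hp, he]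
    push_cast
    simp only [← add_sub_assoc, Finset.sum_add_distrib, Finset.sum_sub_distrib]
    ring_nf
    simp only [Finset.sum_const_zero, add_zero]
  have hT : ∀ i, (1 / 2) * ∑ k, (termForm r k (tDir r i) : ℂ) ^ 2
          * (termSign r k * Complex.exp (termForm r k w))
        + flux r i w * logDerivKernel (Complex.I * lam) (sumForm r)
          (xForm r (Fin.last (r + 1))) (uForm r (Fin.last r)) (termForm r) (tDir r i) w
      = (1 / 2) * (e (.a i) + e (.b i) - e (.d i)
            - (Fin.cons 0 (fun j => e (.g j)) : Fin (r + 1) → ℂ) i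
            + if i = Fin.last r then e .c - e .h else 0)
          + (1 / 2) * (e (.a i) - e (.b i) + e (.d i)
              - (Fin.cons 0 (fun j => e (.g j)) : Fin (r + 1) → ℂ) i
              + if i = Fin.last r then e .h - e .c else 0)
            * (-2 * (Complex.I * lam) - e (.a i) + e (.b i) + e (.d i)
              - (Fin.cons 0 (fun j => e (.g j)) : Fin (r + 1) → ℂ) i
              + if i = Fin.last r then e .c + e .h else 0) := by
    intro i
    simp only [flux, logDerivKernel, mul_assoc ((termForm r _ (tDir r _) : ℝ) : ℂ) (termSign r _),
      st, st1, st2, hcons, xt, ut, sumForm_tDir]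
    simp only [termSign, he]
    split_ifs <;> push_cast <;> ring
  rw [hX, hU, hpx, hpu, Finset.sum_congr rfl fun i _ => hT i]
  have hI : (Complex.I * lam) ^ 2 = -lam ^ 2 := by rw [mul_pow, Complex.I_sq]; ring
  linear_combination K * key - K / 2 * hI

end Intertwining

theorem hamiltonian_eq_fderiv (m : ℕ) {f : (Fin (m + 1) → ℝ) → ℂ} (hf : Tame 2 f)
    (x : Fin (m + 1) → ℝ) :
    hamiltonian m f x
      = -(1 / 2 : ℂ) * ∑ j, fderiv ℝ (fun x => fderiv ℝ f x (Pi.single j 1)) x (Pi.single j 1)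
        + potential m x * f x := by
  rw [hamiltonian, potential]
  congr 2
  refine Finset.sum_congr rfl fun j _ => ?_
  have h1 : ∀ g : (Fin (m + 1) → ℝ) → ℂ, Differentiable ℝ g → ∀ t,
      HasDerivAt (fun t => g (Function.update x j t))
        (fderiv ℝ g (Function.update x j t) (Pi.single j 1)) t := fun g hg t =>
    (hg _).hasFDerivAt.comp_hasDerivAt t (hasDerivAt_update x j t)
  have h2 : deriv (fun t => f (Function.update x j t))
      = fun t => fderiv ℝ f (Function.update x j t) (Pi.single j 1) :=
    funext fun t => (h1 f hf.1 t).deriv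
  rw [iteratedDeriv_succ, iteratedDeriv_one, h2, (h1 _ (hf.2.2 (Pi.single j 1)).1 (x j)).deriv,
    Function.update_eq_self]

/-! ### One step of the recursion on eigenfunctions -/

section Step

variable {r : ℕ}

instance isAddHaarMeasure_volume_prod {k l : ℕ} :
    (volume : Measure ((Fin k → ℝ) × (Fin l → ℝ))).IsAddHaarMeasure :=
  Measure.prod.instIsAddHaarMeasure volume volume

/-- The raising operator given by the recursive kernel. -/
def raise (lam : ℂ) (f : (Fin (r + 1) → ℝ) → ℂ) (x : Fin (r + 2) → ℝ) : ℂ :=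
  ∫ y : (Fin (r + 1) → ℝ) × (Fin (r + 1) → ℝ), todaKernel r lam (x, y) * f y.1

theorem Tame.comp_fst {n : ℕ} {f : (Fin (r + 1) → ℝ) → ℂ} (hf : Tame n f) :
    Tame n (fun y : (Fin (r + 1) → ℝ) × (Fin (r + 1) → ℝ) => f y.1) :=
  hf.comp_clm (ContinuousLinearMap.fst ℝ (Fin (r + 1) → ℝ) (Fin (r + 1) → ℝ))

theorem fderiv_comp_fst {f : (Fin (r + 1) → ℝ) → ℂ} (hf : Differentiable ℝ f)
    (y v : (Fin (r + 1) → ℝ) × (Fin (r + 1) → ℝ)) :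
    fderiv ℝ (fun y : (Fin (r + 1) → ℝ) × (Fin (r + 1) → ℝ) => f y.1) y v
      = fderiv ℝ f y.1 v.1 := by
  have := ((hf y.1).hasFDerivAt.comp y hasFDerivAt_fst).fderiv
  rw [Function.comp_def] at this
  rw [this]
  rfl

theorem tame_raise (n : ℕ) {k : ℕ} (lam : ℂ) {f : (Fin (r + 1) → ℝ) → ℂ} (hf : Tame k f) :
    Tame n (raise lam f) :=
  (rapid_todaKernel r n lam).tame_integral hf.comp_fst

/-- Integrate the intertwining relation against f(x'): H_{x'} is symmetric under integration by
parts and acts on f as c, while the divergence in t disappears because f does not depend on t. -/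
theorem hamiltonian_raise (lam : ℂ) {f : (Fin (r + 1) → ℝ) → ℂ} (hf : Tame 2 f) {c : ℂ}
    (hc : ∀ u, hamiltonian r f u = c * f u) (x : Fin (r + 2) → ℝ) :
    hamiltonian (r + 1) (raise lam f) x = (c + lam ^ 2 / 2) * raise lam f x := by
  have hG := rapid_todaKernel r 2 lam
  have hφ := hf.comp_fst
  set φ : (Fin (r + 1) → ℝ) × (Fin (r + 1) → ℝ) → ℂ := fun y => f y.1 with hφdef
  have hxx : ∀ j : Fin (r + 2),
      fderiv ℝ (fun x => fderiv ℝ (raise lam f) x (Pi.single j 1)) x (Pi.single j 1)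
        = ∫ y, fderiv ℝ (fun w => fderiv ℝ (todaKernel r lam) w (xDir r j)) (x, y) (xDir r j)
            * φ y := by
    intro j
    have h1 : (fun x => fderiv ℝ (raise lam f) x (Pi.single j 1))
        = fun x => ∫ y, fderiv ℝ (todaKernel r lam) (x, y) (xDir r j) * φ y :=
      funext fun x => hG.fderiv_integral hφ x (Pi.single j 1)
    rw [h1]
    exact Rapid.fderiv_integral (hG.2.2 (xDir r j)) hφ x (Pi.single j 1)
  -- Two integrations by parts, with two sign changes.
  have huu : ∀ i : Fin (r + 1),
      ∫ y, fderiv ℝ (fun w => fderiv ℝ (todaKernel r lam) w (uDir r i)) (x, y) (uDir r i) * φ y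
        = ∫ y, todaKernel r lam (x, y)
          * fderiv ℝ (fun u => fderiv ℝ f u (Pi.single i 1)) y.1 (Pi.single i 1) := by
    intro i
    have h1 := Rapid.integral_fderiv_mul (μ := volume) (hG.2.2 (uDir r i)) hφ x (Pi.single i 1, 0)
    have h2 := Rapid.integral_fderiv_mul (μ := volume) hG (hφ.2.2 (Pi.single i 1, 0)) x
      (Pi.single i 1, 0)
    have h3 : (fun w => fderiv ℝ φ w (Pi.single i 1, 0))
        = fun w => fderiv ℝ f w.1 (Pi.single i 1) :=
      funext fun w => fderiv_comp_fst hf.1 w _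
    simp only [h3, fderiv_comp_fst (hf.2.2 (Pi.single i 1)).1] at h2
    rw [← neg_eq_iff_eq_neg.2 h2]
    refine h1.trans ?_
    simp only [congrFun h3]
    rfl
  have htt : ∀ i : Fin (r + 1),
      ∫ y, fderiv ℝ (fun w => flux r i w * todaKernel r lam w) (x, y) (tDir r i) * φ y = 0 := by
    intro i
    have h1 := Rapid.integral_fderiv_mul (μ := volume) ((tame_flux r 2 i).mul_rapid hG) hφ x
      (0, Pi.single i 1)
    have h2 : ∀ y, fderiv ℝ φ y (0, Pi.single i 1) = 0 := fun y => by
      rw [hφdef, fderiv_comp_fst hf.1]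
      simp
    simp only [h2, mul_zero, integral_zero, neg_zero] at h1
    exact h1
  have ixx : ∀ j, Integrable fun y =>
      fderiv ℝ (fun w => fderiv ℝ (todaKernel r lam) w (xDir r j)) (x, y) (xDir r j) * φ y :=
    fun j => Rapid.integrable_mul ((hG.2.2 (xDir r j)).2.2 (xDir r j)) hφ x
  have iuu : ∀ i, Integrable fun y =>
      fderiv ℝ (fun w => fderiv ℝ (todaKernel r lam) w (uDir r i)) (x, y) (uDir r i) * φ y :=
    fun i => Rapid.integrable_mul ((hG.2.2 (uDir r i)).2.2 (uDir r i)) hφ x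
  have itt : ∀ i, Integrable fun y =>
      fderiv ℝ (fun w => flux r i w * todaKernel r lam w) (x, y) (tDir r i) * φ y :=
    fun i => Rapid.integrable_mul (((tame_flux r 2 i).mul_rapid hG).2.2 (tDir r i)) hφ x
  have i0 : Integrable fun y => todaKernel r lam (x, y) * φ y := hG.integrable_mul hφ x
  have iu : ∀ i, Integrable fun y : (Fin (r + 1) → ℝ) × (Fin (r + 1) → ℝ) =>
      todaKernel r lam (x, y)
        * fderiv ℝ (fun u => fderiv ℝ f u (Pi.single i 1)) y.1 (Pi.single i 1) := fun i =>
    hG.integrable_mul (Tame.comp_fst ((hf.2.2 (Pi.single i 1)).2.2 (Pi.single i 1))) x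
  have hpot : ∀ u, potential r u * f u = c * f u + (1 / 2 : ℂ)
      * ∑ i, fderiv ℝ (fun u => fderiv ℝ f u (Pi.single i 1)) u (Pi.single i 1) := by
    intro u
    rw [← hc u, hamiltonian_eq_fderiv r hf u]
    ring
  rw [hamiltonian_eq_fderiv (r + 1) (tame_raise 2 lam hf) x]
  simp only [hxx]
  -- The intertwining relation solved for the second x-derivatives, with the potential at x'
  -- eliminated by the eigenvalue equation of f.
  have hpt : ∀ y, ∑ j, fderiv ℝ (fun w => fderiv ℝ (todaKernel r lam) w (xDir r j)) (x, y)
        (xDir r j) * φ y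
      = ∑ i, fderiv ℝ (fun w => fderiv ℝ (todaKernel r lam) w (uDir r i)) (x, y)
          (uDir r i) * φ y
        - ∑ i, todaKernel r lam (x, y)
          * fderiv ℝ (fun u => fderiv ℝ f u (Pi.single i 1)) y.1 (Pi.single i 1)
        + 2 * (potential (r + 1) x - c - lam ^ 2 / 2) * (todaKernel r lam (x, y) * φ y)
        - 2 * ∑ i, fderiv ℝ (fun w => flux r i w * todaKernel r lam w) (x, y) (tDir r i)
          * φ y := by
    intro y
    have h1 := todaKernel_intertwining lam (x, y)
    have h2 := hpot y.1
    simp only at h1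
    simp only [← Finset.sum_mul, ← Finset.mul_sum]
    linear_combination (-2 * φ y) * h1 - 2 * todaKernel r lam (x, y) * h2
  rw [← integral_finsetSum _ fun j _ => ixx j]
  simp only [hpt]
  have s1 := integrable_finsetSum (μ := volume) Finset.univ fun i _ => iuu i
  have s2 := integrable_finsetSum (μ := volume) Finset.univ fun i _ => iu i
  have s3 := i0.const_mul (2 * ((potential (r + 1) x : ℂ) - c - lam ^ 2 / 2))
  have s4 := (integrable_finsetSum (μ := volume) Finset.univ fun i _ => itt i).const_mul 2
  have hA : ∫ y, todaKernel r lam (x, y) * φ y = raise lam f x := rfl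
  rw [integral_sub ((s1.sub' s2).fun_add s3) s4, integral_add (s1.sub' s2) s3, integral_sub s1 s2,
    integral_finsetSum _ fun i _ => iuu i, integral_finsetSum _ fun i _ => iu i,
    integral_const_mul, integral_const_mul, integral_finsetSum _ fun i _ => itt i, hA]
  simp only [huu, htt, Finset.sum_const_zero]
  ring

end Step

/-! ### Absolute integrability against a rapidly decaying kernel -/

section ProductIntegrability

variable {E Y T : Type*} [NormedAddCommGroup E] [NormedSpace ℝ E] [FiniteDimensional ℝ E]
  [MeasurableSpace E] [NormedAddCommGroup Y] [NormedSpace ℝ Y] [FiniteDimensional ℝ Y]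
  [MeasurableSpace Y] [BorelSpace Y] {μ : Measure Y} [μ.IsAddHaarMeasure]
  [MeasurableSpace T] {ν : Measure T} [SFinite ν]

/-- The inductive step for absolute convergence. The L¹ norm over the upper rows is exponentially
bounded in the row y, the kernel absorbs that growth, and the new L¹ norm is exponentially bounded
in x. -/
theorem RapidlyDecaying.mul_integrable {f : T × Y → ℂ} {ρ : E × Y → ℂ} (hρ : RapidlyDecaying ρ)
    (hf : Measurable f) (hρm : Measurable ρ) (hf_int : ∀ y, Integrable (fun s => f (s, y)) ν)
    (hbd : ∃ C A : ℝ, ∀ y, ∫ s, ‖f (s, y)‖ ∂ν ≤ C * Real.exp (A * ‖y‖)) :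
    (∀ x, Integrable (fun p : T × Y => f p * ρ (x, p.2)) (ν.prod μ)) ∧
    ∃ C A : ℝ, ∀ x, ∫ p, ‖f p * ρ (x, p.2)‖ ∂ν.prod μ ≤ C * Real.exp (A * ‖x‖) := by
  have hNm : StronglyMeasurable fun y => ∫ s, ‖f (s, y)‖ ∂ν :=
    hf.norm.stronglyMeasurable.integral_prod_left'
  have hNnorm : ∀ y, ‖((∫ s, ‖f (s, y)‖ ∂ν : ℝ) : ℂ)‖ = ∫ s, ‖f (s, y)‖ ∂ν := fun y => by
    rw [Complex.norm_real, Real.norm_of_nonneg (integral_nonneg fun s => norm_nonneg _)]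
  have hN : ExpBounded fun y => ((∫ s, ‖f (s, y)‖ ∂ν : ℝ) : ℂ) := by
    obtain ⟨C, A, h⟩ := hbd
    exact ⟨C, A, fun y => (hNnorm y).trans_le (h y)⟩
  have hρx : ∀ x, Measurable fun y => ρ (x, y) := fun x =>
    hρm.comp (measurable_const.prodMk measurable_id)
  have hprod : ∀ x, Integrable (fun p : T × Y => f p * ρ (x, p.2)) (ν.prod μ) := by
    intro x
    refine (integrable_prod_iff' ?_).2 ⟨Filter.Eventually.of_forall fun y => ?_, ?_⟩
    · exact (hf.mul ((hρx x).comp measurable_snd)).aestronglyMeasurable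
    · exact (hf_int y).mul_const (ρ (x, y))
    · obtain ⟨C, A, -, -, h⟩ := hρ.mul_bound hN
      refine (integrable_exp_neg_norm.const_mul (C * Real.exp (A * ‖x‖))).mono' ?_
        (Filter.Eventually.of_forall fun y => ?_)
      · simp only [norm_mul, integral_mul_const]
        exact (hNm.measurable.mul (hρx x).norm).aestronglyMeasurable
      · simp only [norm_mul, integral_mul_const]
        rw [norm_norm, Real.norm_of_nonneg (integral_nonneg fun s => norm_nonneg _),
          mul_comm, ← hNnorm]
        exact h x y
  refine ⟨hprod, ?_⟩
  obtain ⟨C, A, h⟩ := hρ.expBounded_integral (μ := μ) hN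
  refine ⟨C, A, fun x => le_trans (le_of_eq ?_) (h x)⟩
  rw [integral_prod_symm _ (hprod x).norm]
  refine integral_congr_ae (Filter.Eventually.of_forall fun y => ?_)
  simp only [norm_mul, integral_mul_const]
  rw [hNnorm, mul_comm]

end ProductIntegrability

/-! ### Splitting the last row off a triangular array -/

section Triangles

@[simp] theorem complete_castSucc {m : ℕ} (X : Triangle m) (x : Fin (m + 1) → ℝ) (k : Fin m) :
    complete X x k.castSucc = X k :=
  Fin.snoc_castSucc (α := fun k : Fin (m + 1) => Fin ((k : ℕ) + 1) → ℝ) x X k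

@[simp] theorem complete_last {m : ℕ} (X : Triangle m) (x : Fin (m + 1) → ℝ) :
    complete X x (Fin.last m) = x :=
  Fin.snoc_last (α := fun k : Fin (m + 1) => Fin ((k : ℕ) + 1) → ℝ) x X

theorem measurable_complete (m : ℕ) :
    Measurable fun p : Triangle m × (Fin (m + 1) → ℝ) => complete p.1 p.2 := by
  refine measurable_pi_iff.2 fun k => ?_
  induction k using Fin.lastCases with
  | last => simpa using measurable_snd
  | cast k =>
    simp only [complete_castSucc]
    exact (measurable_pi_apply k).comp measurable_fst

/-- Boxes determine the product measure, and the preimage of a box is a box. This is what allows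
Fubini over the last row. -/
theorem measurePreserving_complete (m : ℕ) :
    MeasurePreserving (fun p : Triangle m × (Fin (m + 1) → ℝ) => complete p.1 p.2)
      (volume.prod volume) volume := by
  refine ⟨measurable_complete m, ?_⟩
  refine (Measure.pi_eq fun s hs => ?_).symm
  rw [Measure.map_apply (measurable_complete m) (MeasurableSet.univ_pi hs)]
  have : (fun p : Triangle m × (Fin (m + 1) → ℝ) => complete p.1 p.2) ⁻¹' Set.univ.pi s
      = (Set.univ.pi fun k : Fin m => s k.castSucc) ×ˢ s (Fin.last m) := by
    ext p
    simp only [Set.mem_preimage, Set.mem_univ_pi, Set.mem_prod]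
    constructor
    · intro h
      exact ⟨fun k => by simpa using h k.castSucc, by simpa using h (Fin.last m)⟩
    · rintro ⟨h1, h2⟩ k
      induction k using Fin.lastCases with
      | last => simpa using h2
      | cast k => simpa using h1 k
  rw [this, Measure.prod_prod, Fin.prod_univ_castSucc]
  congr 1
  exact Measure.pi_pi _ _

end Triangles

/-! ### Convergence, decay and measurability of the recursive kernel -/

section RecursiveKernel

variable (r : ℕ) (lam : ℂ)

theorem recKernel_eq (x : Fin (r + 2) → ℝ) (u : Fin (r + 1) → ℝ) :
    recKernel r lam x u = ∫ t, todaKernel r lam (x, (u, t)) := by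
  simp only [recKernel, recIntegrand_eq_todaKernel]

theorem continuous_todaKernel : Continuous (todaKernel r lam) :=
  (rapid_todaKernel r 0 lam).continuous

theorem norm_todaKernel_le (B : ℝ) : ∃ C A : ℝ, 0 ≤ C ∧ 0 ≤ A ∧ ∀ x u t,
    ‖todaKernel r lam (x, (u, t))‖
      ≤ C * Real.exp (A * ‖x‖ - B * ‖u‖) * Real.exp (-‖t‖) := by
  -- The rate |B| is spent on u and the remaining 1 on t, both norms being at most ‖(u, t)‖.
  obtain ⟨C, A, hC, hA, h⟩ := (rapid_todaKernel r 0 lam).bound.exists_pos (|B| + 1)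
  refine ⟨C, A, hC, hA, fun x u t => (h x (u, t)).trans ?_⟩
  rw [mul_assoc, ← Real.exp_add]
  gcongr
  have h1 : ‖u‖ ≤ ‖(u, t)‖ := le_max_left _ _
  have h2 : ‖t‖ ≤ ‖(u, t)‖ := le_max_right _ _
  have h3 : B * ‖u‖ ≤ |B| * ‖(u, t)‖ :=
    mul_le_mul (le_abs_self B) h1 (norm_nonneg _) (abs_nonneg _)
  linarith

theorem integrable_recIntegrand (x : Fin (r + 2) → ℝ) (u : Fin (r + 1) → ℝ) :
    Integrable (recIntegrand r lam x u) := by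
  obtain ⟨C, A, -, -, h⟩ := norm_todaKernel_le r lam 0
  have hc := continuous_todaKernel r lam
  refine (integrable_exp_neg_norm.const_mul (C * Real.exp (A * ‖x‖ - 0 * ‖u‖))).mono' ?_
    (Filter.Eventually.of_forall fun t => ?_)
  · simp only [funext (recIntegrand_eq_todaKernel r lam x u)]
    exact (by fun_prop : Continuous fun t => todaKernel r lam (x, (u, t))).aestronglyMeasurable
  · rw [recIntegrand_eq_todaKernel]
    exact h x u t

theorem rapidlyDecaying_recKernel :
    RapidlyDecaying (fun p : (Fin (r + 2) → ℝ) × (Fin (r + 1) → ℝ) =>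
      recKernel r lam p.1 p.2) := by
  intro B
  obtain ⟨C, A, hC, hA, h⟩ := norm_todaKernel_le r lam B
  refine ⟨C * ∫ t : Fin (r + 1) → ℝ, Real.exp (-‖t‖), A, fun x u => ?_⟩
  simp only [recKernel_eq]
  calc ‖∫ t, todaKernel r lam (x, (u, t))‖
      ≤ ∫ t : Fin (r + 1) → ℝ, C * Real.exp (A * ‖x‖ - B * ‖u‖) * Real.exp (-‖t‖) :=
        norm_integral_le_of_norm_le (integrable_exp_neg_norm.const_mul _)
          (Filter.Eventually.of_forall fun t => h x u t)
    _ = C * (∫ t : Fin (r + 1) → ℝ, Real.exp (-‖t‖)) * Real.exp (A * ‖x‖ - B * ‖u‖) := by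
        rw [integral_const_mul]
        ring

theorem measurable_recKernel :
    Measurable fun p : (Fin (r + 2) → ℝ) × (Fin (r + 1) → ℝ) => recKernel r lam p.1 p.2 := by
  have hc := continuous_todaKernel r lam
  simp only [recKernel_eq]
  refine StronglyMeasurable.measurable (StronglyMeasurable.integral_prod_right
    (f := fun (p : (Fin (r + 2) → ℝ) × (Fin (r + 1) → ℝ)) t =>
      todaKernel r lam (p.1, (p.2, t))) ?_)
  refine Continuous.stronglyMeasurable ?_
  simp only [Function.uncurry_def]
  fun_prop

end RecursiveKernel

/-! ### The wave function by induction on the rank -/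

section Wave

theorem waveIntegrand_complete (m : ℕ) (lam : Fin (m + 2) → ℂ) (x : Fin (m + 2) → ℝ)
    (X : Triangle m) (u : Fin (m + 1) → ℝ) :
    waveIntegrand (m + 1) lam x (complete X u)
      = waveIntegrand m (fun i => lam i.castSucc) u X
        * recKernel m (lam (Fin.last (m + 1))) x u := by
  have h1 : ∀ k : Fin m, complete (complete X u) x k.castSucc.succ = complete X u k.succ :=
    fun k => complete_castSucc (complete X u) x k.succ
  have h2 : complete (complete X u) x (Fin.last m).succ = x :=
    complete_last (complete X u) x
  have h3 : complete (complete X u) x (Fin.last m).castSucc = u := by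
    rw [complete_castSucc, complete_last]
  rw [waveIntegrand, waveIntegrand, Fin.prod_univ_castSucc, ← mul_assoc]
  congr 1
  · congr 1
    refine Finset.prod_congr rfl fun k _ => ?_
    rw [h1, complete_castSucc]
    rfl
  · rw [h2, h3]
    rfl

theorem measurable_waveIntegrand (m : ℕ) (lam : Fin (m + 1) → ℂ) :
    Measurable fun p : Triangle m × (Fin (m + 1) → ℝ) => waveIntegrand m lam p.2 p.1 := by
  have hc : ∀ k : Fin (m + 1), Measurable fun p : Triangle m × (Fin (m + 1) → ℝ) =>
      complete p.1 p.2 k := fun k => measurable_pi_iff.1 (measurable_complete m) k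
  unfold waveIntegrand
  refine Measurable.mul ?_ (Finset.measurable_fun_prod _ fun k _ => ?_)
  · have h : Measurable fun p : Triangle m × (Fin (m + 1) → ℝ) => complete p.1 p.2 0 0 :=
      measurable_pi_iff.1 (hc 0) 0
    fun_prop
  · have h1 : Measurable fun p : Triangle m × (Fin (m + 1) → ℝ) =>
        (complete p.1 p.2 k.succ : Fin ((k : ℕ) + 2) → ℝ) := hc k.succ
    have h2 : Measurable fun p : Triangle m × (Fin (m + 1) → ℝ) =>
        (complete p.1 p.2 k.castSucc : Fin ((k : ℕ) + 1) → ℝ) := hc k.castSucc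
    have h3 := (measurable_recKernel k (lam k.succ)).comp (h1.prodMk h2)
    exact h3

theorem volume_triangle_zero :
    (volume : Measure (Triangle 0)) = Measure.dirac fun k => k.elim0 :=
  Measure.pi_of_empty _ _

theorem waveIntegrand_zero (lam : Fin 1 → ℂ) (x : Fin 1 → ℝ) (X : Triangle 0) :
    waveIntegrand 0 lam x X = Complex.exp (Complex.I * lam 0 * x 0) := by
  have h : complete X x 0 = x := complete_last X x
  simp [waveIntegrand, h]

theorem wave_zero (lam : Fin 1 → ℂ) :
    wave 0 lam = fun x => Complex.exp (Complex.I * lam 0 * x 0) := by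
  funext x
  simp [wave, waveIntegrand_zero, volume_triangle_zero]

variable (m : ℕ) (lam : Fin (m + 2) → ℂ)

theorem measurable_waveIntegrand_right (m : ℕ) (lam : Fin (m + 1) → ℂ) (x : Fin (m + 1) → ℝ) :
    Measurable (waveIntegrand m lam x) := by
  have h : Measurable fun X : Triangle m => (X, x) := measurable_id.prodMk measurable_const
  have h' := (measurable_waveIntegrand m lam).comp h
  exact h'

theorem integral_triangle_succ {F : Type*} [NormedAddCommGroup F] [NormedSpace ℝ F] (m : ℕ)
    {f : Triangle (m + 1) → F} (hf : AEStronglyMeasurable f volume) :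
    ∫ X, f X = ∫ p : Triangle m × (Fin (m + 1) → ℝ), f (complete p.1 p.2) ∂volume.prod volume := by
  rw [← (measurePreserving_complete m).map_eq] at hf ⊢
  exact integral_map (measurable_complete m).aemeasurable hf

theorem integrable_waveIntegrand_and_bound (m : ℕ) (lam : Fin (m + 1) → ℂ) :
    (∀ x, Integrable (waveIntegrand m lam x)) ∧
    ∃ C A : ℝ, ∀ x, ∫ X, ‖waveIntegrand m lam x X‖ ≤ C * Real.exp (A * ‖x‖) := by
  induction m with
  | zero =>
    constructor
    · intro x
      rw [volume_triangle_zero]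
      simp only [funext (waveIntegrand_zero lam x)]
      exact integrable_const _
    · obtain ⟨C, A, h⟩ := (Tame.cexp_const_mul_clm 0 (Complex.I * lam 0)
        (ContinuousLinearMap.proj (R := ℝ) (φ := fun _ : Fin 1 => ℝ) 0)).bound
      refine ⟨C, A, fun x => ?_⟩
      simpa [volume_triangle_zero, waveIntegrand_zero] using h x
  | succ m ih =>
    obtain ⟨h1, h2⟩ := (rapidlyDecaying_recKernel m (lam (Fin.last (m + 1)))).mul_integrable
      (μ := volume) (measurable_waveIntegrand m fun i => lam i.castSucc)
      (measurable_recKernel m (lam (Fin.last (m + 1)))) (ih _).1 (ih _).2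
    constructor
    · intro x
      rw [← (measurePreserving_complete m).integrable_comp
        (measurable_waveIntegrand_right (m + 1) lam x).aestronglyMeasurable]
      simp only [Function.comp_def, waveIntegrand_complete]
      exact h1 x
    · obtain ⟨C, A, h⟩ := h2
      refine ⟨C, A, fun x => ?_⟩
      rw [integral_triangle_succ m
        (measurable_waveIntegrand_right (m + 1) lam x).norm.aestronglyMeasurable]
      simp only [waveIntegrand_complete]
      exact h x

/-- Fubini twice: the array splits into its upper rows and its last row u, and the integral over (u,
t) in `raise` into the one over t, which is the recursive kernel, and the one over u. -/
theorem wave_succ {k : ℕ} (h : Tame k (wave m fun i => lam i.castSucc)) :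
    wave (m + 1) lam
      = raise (lam (Fin.last (m + 1))) (wave m fun i => lam i.castSucc) := by
  funext x
  have hprod := ((rapidlyDecaying_recKernel m (lam (Fin.last (m + 1)))).mul_integrable
      (μ := volume) (measurable_waveIntegrand m fun i => lam i.castSucc)
      (measurable_recKernel m (lam (Fin.last (m + 1))))
      (integrable_waveIntegrand_and_bound m _).1 (integrable_waveIntegrand_and_bound m _).2).1 x
  rw [wave, integral_triangle_succ m
    (measurable_waveIntegrand_right (m + 1) lam x).aestronglyMeasurable]
  simp only [waveIntegrand_complete]
  rw [integral_prod_symm _ hprod, raise]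
  have hf_int : Integrable fun y : (Fin (m + 1) → ℝ) × (Fin (m + 1) → ℝ) =>
      todaKernel m (lam (Fin.last (m + 1))) (x, y) * wave m (fun i => lam i.castSucc) y.1 :=
    (rapid_todaKernel m 0 _).integrable_mul h.comp_fst x
  refine Eq.trans ?_ (integral_prod _ hf_int).symm
  refine integral_congr_ae (Filter.Eventually.of_forall fun u => ?_)
  simp only [integral_mul_const]
  rw [recKernel_eq, mul_comm]
  rfl

theorem tame_wave_and_hamiltonian_wave (m : ℕ) (lam : Fin (m + 1) → ℂ) :
    Tame 2 (wave m lam) ∧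
    ∀ x, hamiltonian m (wave m lam) x = (1 / 2 : ℂ) * (∑ i, lam i ^ 2) * wave m lam x := by
  induction m with
  | zero =>
    have ht : Tame 2 (wave 0 lam) := by
      rw [wave_zero]
      exact Tame.cexp_const_mul_clm 2 (Complex.I * lam 0)
        (ContinuousLinearMap.proj (R := ℝ) (φ := fun _ : Fin 1 => ℝ) 0)
    refine ⟨ht, fun x => ?_⟩
    have h1 := fderiv_cexp_const_mul_clm (Complex.I * lam 0)
        (ContinuousLinearMap.proj (R := ℝ) (φ := fun _ : Fin 1 => ℝ) 0)
    have h2 := (Tame.cexp_const_mul_clm 1 (Complex.I * lam 0)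
        (ContinuousLinearMap.proj (R := ℝ) (φ := fun _ : Fin 1 => ℝ) 0)).1
    rw [hamiltonian_eq_fderiv 0 ht, wave_zero]
    simp only [ContinuousLinearMap.proj_apply] at h1 h2
    simp only [h1, fderiv_const_mul (h2 x), potential, boundaryPotential, smul_apply, smul_eq_mul]
    simp
    linear_combination (-(1 / 2) * lam 0 ^ 2 * Complex.exp (Complex.I * lam 0 * x 0))
      * Complex.I_sq
  | succ m ih =>
    obtain ⟨h1, h2⟩ := ih fun i => lam i.castSucc
    rw [wave_succ m lam h1]
    refine ⟨tame_raise 2 _ h1, fun x => ?_⟩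
    rw [hamiltonian_raise _ h1 h2, Fin.sum_univ_castSucc (fun i => lam i ^ 2)]
    ring

end Wave

/-! ### The Gamma integral on a bent contour -/

section GammaContour

open Set

/-- The integrand of the Gamma integral in the exponential variable `w`. -/
def gammaIntegrand (S : ℝ) (a w : ℂ) : ℂ :=
  Complex.exp (-(a * w)) * Complex.exp (-(S * Complex.exp (-w)))

theorem continuous_gammaIntegrand (S : ℝ) (a : ℂ) : Continuous (gammaIntegrand S a) := by
  unfold gammaIntegrand
  fun_prop

theorem norm_gammaIntegrand_le_exp {S : ℝ} (hS : 0 < S) (a : ℂ) :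
    ∃ C : ℝ, ∀ s : ℝ, s ≤ 0 → ‖gammaIntegrand S a s‖ ≤ C * Real.exp s := by
  -- Since exp(-S e^{-s}) is at most (n!/S^n) e^{ns}, this n leaves e^{(n - Re a)s}, which is at
  -- most e^s for s ≤ 0.
  obtain ⟨n, hn⟩ := exists_nat_ge (a.re + 1)
  refine ⟨n.factorial / S ^ n, fun s hs => ?_⟩
  have h1 := Real.pow_div_factorial_le_exp (S * Real.exp (-s)) (by positivity) n
  have h2 : ‖gammaIntegrand S a s‖ = Real.exp (-(a.re * s)) * Real.exp (-(S * Real.exp (-s))) := by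
    rw [gammaIntegrand, norm_mul, Complex.norm_exp, Complex.norm_exp]
    congr 2
    · simp
    · rw [← Complex.ofReal_neg, ← Complex.ofReal_exp, ← Complex.ofReal_mul, ← Complex.ofReal_neg,
        Complex.ofReal_re]
  have h3 : Real.exp (-(S * Real.exp (-s))) ≤ n.factorial / S ^ n * Real.exp (n * s) := by
    rw [Real.exp_neg, inv_le_comm₀ (Real.exp_pos _) (by positivity)]
    refine le_trans (le_of_eq ?_) h1
    rw [mul_pow, ← Real.exp_nat_mul, mul_neg, Real.exp_neg]
    field_simp
  rw [h2]
  calc Real.exp (-(a.re * s)) * Real.exp (-(S * Real.exp (-s)))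
      ≤ Real.exp (-(a.re * s)) * (n.factorial / S ^ n * Real.exp (n * s)) := by gcongr
    _ = n.factorial / S ^ n * Real.exp (-(a.re * s) + n * s) := by rw [Real.exp_add]; ring
    _ ≤ n.factorial / S ^ n * Real.exp s := by
        gcongr
        nlinarith

theorem integrableOn_gammaIntegrand_Iic {S : ℝ} (hS : 0 < S) (a : ℂ) :
    IntegrableOn (fun s : ℝ => gammaIntegrand S a s) (Iic 0) := by
  obtain ⟨C, hC⟩ := norm_gammaIntegrand_le_exp hS a
  have hc := continuous_gammaIntegrand S a
  refine Integrable.mono' ((integrableOn_exp_Iic 0).const_mul C)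
    (by fun_prop : Continuous fun s : ℝ => gammaIntegrand S a s).aestronglyMeasurable ?_
  exact (ae_restrict_mem measurableSet_Iic).mono fun s hs => hC s hs

theorem gammaIntegrand_add_one (S : ℝ) (a w : ℂ) :
    gammaIntegrand S (a + 1) w = Complex.exp (-w) * gammaIntegrand S a w := by
  rw [gammaIntegrand, gammaIntegrand, ← mul_assoc, ← Complex.exp_add (-w)]
  ring_nf

/-- Integrates the derivative of the integrand over the half-line; the value at 0 gives e^{-S}, and
the integrand vanishes at -∞. -/
theorem integral_gammaIntegrand_Iic_recursion {S : ℝ} (hS : 0 < S) (a : ℂ) :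
    a * ∫ s : ℝ in Iic 0, gammaIntegrand S a s
      = S * (∫ s : ℝ in Iic 0, gammaIntegrand S (a + 1) s) - Complex.exp (-S) := by
  have hd : ∀ s : ℝ, HasDerivAt (fun s : ℝ => gammaIntegrand S a s)
      (S * gammaIntegrand S (a + 1) s - a * gammaIntegrand S a s) s := by
    intro s
    have h0 : HasDerivAt (fun s : ℝ => (s : ℂ)) 1 s := Complex.ofRealCLM.hasDerivAt
    have h1 := ((h0.const_mul a).neg.cexp).mul (((h0.neg.cexp).const_mul (S : ℂ)).neg.cexp)
    refine (h1.congr_deriv ?_)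
    rw [gammaIntegrand_add_one, gammaIntegrand]
    simp only [Pi.neg_apply]
    ring
  have h1 := (integrableOn_gammaIntegrand_Iic hS (a + 1)).const_mul (S : ℂ)
  have h2 := (integrableOn_gammaIntegrand_Iic hS a).const_mul a
  have ht : Filter.Tendsto (fun s : ℝ => gammaIntegrand S a s) Filter.atBot (nhds 0) := by
    obtain ⟨C, hC⟩ := norm_gammaIntegrand_le_exp hS a
    refine squeeze_zero_norm' ((Filter.eventually_le_atBot 0).mono fun s hs => hC s hs) ?_
    simpa using Real.tendsto_exp_atBot.const_mul C
  have h := integral_Iic_of_hasDerivAt_of_tendsto' (a := (0 : ℝ)) (fun s _ => hd s)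
    (h1.sub h2) ht
  rw [integral_sub h1 h2, integral_const_mul, integral_const_mul] at h
  have h3 : gammaIntegrand S a ((0 : ℝ) : ℂ) = Complex.exp (-S) := by simp [gammaIntegrand]
  rw [h3] at h
  linear_combination -h

theorem norm_cexp_neg_mul_le_one {ω : ℂ} (hω : 0 ≤ ω.re) {s : ℝ} (hs : 0 ≤ s) :
    ‖Complex.exp (-(s * ω))‖ ≤ 1 := by
  rw [Complex.norm_exp, Real.exp_le_one_iff]
  simp only [Complex.neg_re, Complex.re_ofReal_mul]
  nlinarith [mul_nonneg hs hω]

theorem integrableOn_gammaIntegrand_ray {S : ℝ} (hS : 0 < S) {a ω : ℂ} (hω : 0 ≤ ω.re)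
    (ha : 0 < (a * ω).re) :
    IntegrableOn (fun s : ℝ => gammaIntegrand S a (s * ω)) (Ioi 0) := by
  have hc := continuous_gammaIntegrand S a
  refine Integrable.mono' ((integrableOn_exp_mul_Ioi (a := -(a * ω).re) (by linarith) 0).const_mul
    (Real.exp S)) (by fun_prop : Continuous fun s : ℝ =>
      gammaIntegrand S a (s * ω)).aestronglyMeasurable ?_
  refine (ae_restrict_mem measurableSet_Ioi).mono fun s hs => ?_
  rw [gammaIntegrand, norm_mul, mul_comm]
  refine mul_le_mul ?_ (le_of_eq ?_) (norm_nonneg _) (Real.exp_pos _).le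
  · refine (Complex.norm_exp_le_exp_norm _).trans ?_
    rw [norm_neg, norm_mul, Complex.norm_real, Real.norm_of_nonneg hS.le]
    gcongr
    exact mul_le_of_le_one_right hS.le (norm_cexp_neg_mul_le_one hω (le_of_lt hs))
  · rw [Complex.norm_exp, show -(a * (s * ω)) = ((-s : ℝ) : ℂ) * (a * ω) by push_cast; ring,
      Complex.re_ofReal_mul]
    ring_nf

/-- Expand exp(-S e^{-w}) and integrate term by term. The factor ω cancels in each term, so the sum
is independent of the ray; this replaces contour rotation. -/
theorem hasSum_integral_gammaIntegrand_ray {S : ℝ} (hS : 0 < S) {a ω : ℂ} (hω : 0 ≤ ω.re)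
    (ha : 0 < (a * ω).re) :
    HasSum (fun n : ℕ => (-(S : ℂ)) ^ n / n.factorial / (a + n))
      (∫ s : ℝ in Ioi 0, gammaIntegrand S a (s * ω) * ω) := by
  have hω0 : ω ≠ 0 := fun h => by simp [h] at ha
  have hre : ∀ n : ℕ, (a * ω).re ≤ ((a + n) * ω).re := by
    intro n
    have : ((n : ℂ) * ω).re = n * ω.re := by
      rw [← Complex.ofReal_natCast, Complex.re_ofReal_mul]
    rw [add_mul, Complex.add_re, this]
    have : 0 ≤ (n : ℝ) * ω.re := by positivity
    linarith
  have hneg : ∀ n : ℕ, (-((a + n) * ω)).re < 0 := fun n => by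
    rw [Complex.neg_re]
    linarith [hre n]
  have hnz : ∀ n : ℕ, (a + n) ≠ 0 := fun n h => by
    have := hneg n
    simp [h] at this
  let F : ℕ → ℝ → ℂ := fun n s =>
    (-(S : ℂ)) ^ n / n.factorial * ω * Complex.exp (-((a + n) * ω) * s)
  have hFint : ∀ n, Integrable (F n) (volume.restrict (Ioi 0)) := fun n =>
    (integrableOn_exp_mul_complex_Ioi (hneg n) 0).const_mul _
  have hFnorm : ∀ n, ∫ s in Ioi 0, ‖F n s‖
      = S ^ n / n.factorial * ‖ω‖ * (1 / ((a + n) * ω).re) := by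
    intro n
    have h1 : ∀ s : ℝ, ‖F n s‖ = S ^ n / n.factorial * ‖ω‖
        * Real.exp (-((a + n) * ω).re * s) := by
      intro s
      simp only [F, norm_mul, norm_div, norm_pow, norm_neg, Complex.norm_real,
        Complex.norm_natCast, Complex.norm_exp, Complex.re_mul_ofReal, Complex.neg_re]
      rw [Real.norm_of_nonneg hS.le]
    simp only [h1]
    rw [integral_const_mul, integral_exp_mul_Ioi (by linarith [hre n]), mul_zero, Real.exp_zero,
      neg_div_neg_eq]
  have hsum : Summable fun n => ∫ s in Ioi 0, ‖F n s‖ := by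
    simp only [hFnorm]
    refine Summable.of_nonneg_of_le (fun n => ?_) (fun n => ?_)
      ((Real.summable_pow_div_factorial S).mul_right (‖ω‖ * (1 / (a * ω).re)))
    · have := ha.trans_le (hre n)
      positivity
    · rw [mul_assoc]
      have := hre n
      gcongr
  have h := hasSum_integral_of_summable_integral_norm hFint hsum
  have hterm : ∀ n, ∫ s in Ioi 0, F n s = (-(S : ℂ)) ^ n / n.factorial / (a + n) := by
    intro n
    simp only [F]
    rw [integral_const_mul, integral_exp_mul_complex_Ioi (hneg n)]
    have := hnz n
    simp
    field_simp
  simp only [hterm] at h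
  refine (setIntegral_congr_fun measurableSet_Ioi fun s _ => ?_ :
    ∫ s : ℝ in Ioi 0, gammaIntegrand S a (s * ω) * ω = ∫ s in Ioi 0, ∑' n, F n s) ▸ h
  have hexp : HasSum (fun n : ℕ => (-(S * Complex.exp (-(s * ω)))) ^ n / n.factorial)
      (Complex.exp (-(S * Complex.exp (-(s * ω))))) := by
    rw [Complex.exp_eq_exp_ℂ]
    exact NormedSpace.expSeries_div_hasSum_exp _
  have h2 := (hexp.mul_left (Complex.exp (-(a * (s * ω))))).mul_right ω
  refine (h2.tsum_eq.symm.trans ?_)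
  refine tsum_congr fun n => ?_
  simp only [F]
  rw [show -((a + n) * ω) * (s : ℂ) = -(a * (s * ω)) + n * (-(s * ω)) by ring, Complex.exp_add,
    Complex.exp_nat_mul, neg_mul_eq_neg_mul (S : ℂ), mul_pow]
  ring

/-- Read off the series: multiplying the n-th term by n, once as (a + n) - a and once by shifting
the index, gives the same sum in two ways. -/
theorem integral_gammaIntegrand_ray_recursion {S : ℝ} (hS : 0 < S) {a ω : ℂ} (hω : 0 ≤ ω.re)
    (ha : 0 < (a * ω).re) :
    a * ∫ s : ℝ in Ioi 0, gammaIntegrand S a (s * ω) * ω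
      = S * (∫ s : ℝ in Ioi 0, gammaIntegrand S (a + 1) (s * ω) * ω) + Complex.exp (-S) := by
  have ha1 : 0 < ((a + 1) * ω).re := by
    rw [add_mul, one_mul, Complex.add_re]
    linarith
  have h1 := hasSum_integral_gammaIntegrand_ray hS hω ha
  have h2 := hasSum_integral_gammaIntegrand_ray hS hω ha1
  set R := ∫ s : ℝ in Ioi 0, gammaIntegrand S a (s * ω) * ω
  set R' := ∫ s : ℝ in Ioi 0, gammaIntegrand S (a + 1) (s * ω) * ω
  have hexp : HasSum (fun n : ℕ => (-(S : ℂ)) ^ n / n.factorial) (Complex.exp (-S)) := by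
    rw [Complex.exp_eq_exp_ℂ]
    exact NormedSpace.expSeries_div_hasSum_exp _
  have hnz : ∀ n : ℕ, a + n ≠ 0 := fun n h => by
    have hn : a = ((-n : ℝ) : ℂ) := by
      push_cast
      linear_combination h
    rw [hn, Complex.re_ofReal_mul] at ha
    have : 0 ≤ (n : ℝ) * ω.re := by positivity
    linarith
  have h3 : HasSum (fun n : ℕ => (n : ℂ) * ((-(S : ℂ)) ^ n / n.factorial / (a + n)))
      (Complex.exp (-S) - a * R) := by
    refine (hexp.sub (h1.mul_left a)).congr_fun fun n => ?_
    have := hnz n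
    field_simp
    ring
  have h4 : HasSum (fun n : ℕ => (n : ℂ) * ((-(S : ℂ)) ^ n / n.factorial / (a + n)))
      (-S * R') := by
    have h5 := (hasSum_nat_add_iff (f := fun n : ℕ =>
      (n : ℂ) * ((-(S : ℂ)) ^ n / n.factorial / (a + n))) (g := -S * R') 1).1
      ((h2.mul_left (-(S : ℂ))).congr_fun fun n => ?_)
    · simpa using h5
    · have h6 := hnz (n + 1)
      have h7 : a + 1 + n ≠ 0 := by
        push_cast at h6
        rwa [add_assoc, add_comm (1 : ℂ)]
      rw [Nat.factorial_succ]
      push_cast at h6 ⊢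
      have h8 : (n : ℂ) + 1 ≠ 0 := by exact_mod_cast Nat.succ_ne_zero n
      field_simp
      ring
  linear_combination -(h3.unique h4)

/-- The substitution v = e^{-s} gives Euler's integral. -/
theorem integral_gammaIntegrand_real {S : ℝ} (hS : 0 < S) {a : ℂ} (ha : 0 < a.re) :
    ∫ s : ℝ, gammaIntegrand S a s = Complex.Gamma a * (S : ℂ) ^ (-a) := by
  have himg : image (fun s : ℝ => Real.exp (-s)) univ = Ioi 0 := by
    ext v
    simp only [image_univ, mem_range, mem_Ioi]
    constructor
    · rintro ⟨s, rfl⟩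
      exact Real.exp_pos _
    · intro hv
      exact ⟨-Real.log v, by rw [neg_neg, Real.exp_log hv]⟩
  have hinj : InjOn (fun s : ℝ => Real.exp (-s)) univ := by
    intro s _ t _ h
    exact neg_injective (Real.exp_injective h)
  have hder : ∀ s ∈ (univ : Set ℝ),
      HasDerivWithinAt (fun s : ℝ => Real.exp (-s)) (-Real.exp (-s)) univ s := by
    intro s _
    simpa using ((hasDerivAt_id s).neg.exp).hasDerivWithinAt (s := univ)
  have h := integral_image_eq_integral_abs_deriv_smul MeasurableSet.univ hder hinj
    (fun v : ℝ => (v : ℂ) ^ (a - 1) * Complex.exp (-(S * v)))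
  rw [himg, Complex.integral_cpow_mul_exp_neg_mul_Ioi ha hS, setIntegral_univ] at h
  have hS' : (S : ℂ) ≠ 0 := by exact_mod_cast hS.ne'
  have hpow : (1 / (S : ℂ)) ^ a = (S : ℂ) ^ (-a) := by
    rw [one_div, Complex.inv_cpow _ _ (by
      rw [Complex.arg_ofReal_of_nonneg hS.le]; exact Real.pi_pos.ne), Complex.cpow_neg]
  rw [hpow] at h
  rw [mul_comm, h]
  refine integral_congr_ae (Filter.Eventually.of_forall fun s => ?_)
  have he : ((Real.exp (-s) : ℝ) : ℂ) ≠ 0 := by exact_mod_cast (Real.exp_pos _).ne'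
  simp only
  rw [abs_neg, abs_of_pos (Real.exp_pos _), Complex.real_smul, ← mul_assoc,
    Complex.cpow_sub _ _ he, Complex.cpow_one, mul_div_cancel₀ _ he, gammaIntegrand,
    Complex.cpow_def_of_ne_zero he, ← Complex.ofReal_log (Real.exp_pos _).le, Real.log_exp]
  push_cast
  ring_nf

/-- Induction on the number n of unit shifts that make Re a positive. Without a shift the ray can be
made real; in the step the terms e^{-S} of the two recursions cancel, leaving the functional
equation of Γ. -/
theorem integral_gammaIntegrand_ray {S : ℝ} (hS : 0 < S) {ω : ℂ} (hω : 0 ≤ ω.re) (n : ℕ) {a : ℂ}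
    (ha : 0 < (a * ω).re) (hn : 0 < a.re + n) :
    (∫ s : ℝ in Iic 0, gammaIntegrand S a s) + ∫ s : ℝ in Ioi 0, gammaIntegrand S a (s * ω) * ω
      = Complex.Gamma a * (S : ℂ) ^ (-a) := by
  induction n generalizing a with
  | zero =>
    rw [Nat.cast_zero, add_zero] at hn
    have ha1 : 0 < (a * 1).re := by rwa [mul_one]
    have h1 := (hasSum_integral_gammaIntegrand_ray hS hω ha).unique
      (hasSum_integral_gammaIntegrand_ray hS (ω := 1) (by simp) ha1)
    have h2 := integrableOn_gammaIntegrand_ray hS (ω := 1) (by simp) ha1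
    simp only [mul_one] at h1 h2
    rw [h1, ← integral_gammaIntegrand_real hS hn]
    exact intervalIntegral.integral_Iic_add_Ioi (integrableOn_gammaIntegrand_Iic hS a) h2
  | succ n ih =>
    have ha1 : 0 < ((a + 1) * ω).re := by
      rw [add_mul, one_mul, Complex.add_re]
      linarith
    have ha0 : a ≠ 0 := fun h => by simp [h] at ha
    have hS' : (S : ℂ) ≠ 0 := by exact_mod_cast hS.ne'
    have h := ih ha1 (by rw [Complex.add_re, Complex.one_re]; push_cast at hn; linarith)
    rw [Complex.Gamma_add_one a ha0, neg_add, Complex.cpow_add _ _ hS',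
      Complex.cpow_neg_one] at h
    have h1 := integral_gammaIntegrand_Iic_recursion hS a
    have h2 := integral_gammaIntegrand_ray_recursion hS hω ha
    refine mul_left_cancel₀ ha0 ?_
    have h3 : (S : ℂ) * (a * Complex.Gamma a * ((S : ℂ) ^ (-a) * (S : ℂ)⁻¹))
        = a * (Complex.Gamma a * (S : ℂ) ^ (-a)) := by
      field_simp
    rw [← h3, ← h]
    linear_combination h1 + h2

theorem yContour_gammaIntegrand {S : ℝ} (hS : 0 < S) {a : ℂ} {θ : ℝ} (hθ : |θ| < Real.pi / 2)
    (ha : 0 < (a * Complex.exp (θ * Complex.I)).re) :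
    Integrable (fun s => gammaIntegrand S a (yContour θ s - Real.pi * Complex.I) * yVelocity θ s) ∧
    ∫ s, gammaIntegrand S a (yContour θ s - Real.pi * Complex.I) * yVelocity θ s
      = Complex.Gamma a * (S : ℂ) ^ (-a) := by
  have hω : 0 ≤ (Complex.exp (θ * Complex.I)).re := by
    rw [Complex.exp_ofReal_mul_I_re]
    exact Real.cos_nonneg_of_mem_Icc ⟨by linarith [(abs_lt.1 hθ).1], (abs_lt.1 hθ).2.le⟩
  have hl : EqOn
      (fun s => gammaIntegrand S a (yContour θ s - Real.pi * Complex.I) * yVelocity θ s)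
      (fun s : ℝ => gammaIntegrand S a s) (Iic 0) := by
    intro s hs
    have hs' : s ≤ 0 := hs
    simp [yContour, yVelocity, hs']
  have hr : EqOn
      (fun s => gammaIntegrand S a (yContour θ s - Real.pi * Complex.I) * yVelocity θ s)
      (fun s : ℝ => gammaIntegrand S a (s * Complex.exp (θ * Complex.I))
        * Complex.exp (θ * Complex.I)) (Ioi 0) := by
    intro s hs
    have hs' : ¬s ≤ 0 := not_le.2 hs
    simp [yContour, yVelocity, hs']
  have h1 := (integrableOn_gammaIntegrand_Iic hS a).congr_fun hl.symm measurableSet_Iic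
  have h2 := IntegrableOn.congr_fun
    ((integrableOn_gammaIntegrand_ray hS hω ha).mul_const (Complex.exp (θ * Complex.I)))
    hr.symm measurableSet_Ioi
  refine ⟨?_, ?_⟩
  · rw [← integrableOn_univ, ← Iic_union_Ioi (a := (0 : ℝ))]
    exact h1.union h2
  · rw [← intervalIntegral.integral_Iic_add_Ioi h1 h2, setIntegral_congr_fun measurableSet_Iic hl,
      setIntegral_congr_fun measurableSet_Ioi hr]
    obtain ⟨n, hn⟩ := exists_nat_gt (-a.re)
    exact integral_gammaIntegrand_ray hS hω n ha (by linarith)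

end GammaContour

/-! ### The second form of the recursive kernel -/

section SecondForm

variable (r : ℕ) (lam : ℂ) (θ : ℝ) (x : Fin (r + 2) → ℝ) (x' : Fin (r + 1) → ℝ)

/-- The two exponentials in y combine to exp(-S e^{-w}), so y separates from z. The factor S^{-2iλ}
cancels the power of S in `recIntegrand`, and the shift of y by iπ produces e^{-2πλ}. -/
theorem altIntegrand_eq (p : (Fin (r + 1) → ℝ) × ℝ) :
    altIntegrand r lam θ x x' p
      = (Complex.exp (-(2 * Real.pi * lam))
          * ((Real.exp (-x (Fin.last (r + 1))) + Real.exp (-x' (Fin.last r)) : ℝ) : ℂ)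
            ^ (-(2 * Complex.I * lam)) * recIntegrand r lam x x' p.1)
        * (gammaIntegrand (Real.exp (-x (Fin.last (r + 1))) + Real.exp (-x' (Fin.last r)))
            (-(2 * Complex.I * lam)) (yContour θ p.2 - Real.pi * Complex.I)
          * yVelocity θ p.2) := by
  obtain ⟨t, s⟩ := p
  have hS : (0 : ℝ) < Real.exp (-x (Fin.last (r + 1))) + Real.exp (-x' (Fin.last r)) := by
    positivity
  have hS' : ((Real.exp (-x (Fin.last (r + 1))) + Real.exp (-x' (Fin.last r)) : ℝ) : ℂ) ≠ 0 := by
    exact_mod_cast hS.ne'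
  generalize hw : yContour θ s - Real.pi * Complex.I = w
  have hy : yContour θ s = w + Real.pi * Complex.I := by rw [← hw]; ring
  have he : ∀ z : ℂ, Complex.exp (z - (w + Real.pi * Complex.I))
      = -(Complex.exp z * Complex.exp (-w)) := by
    intro z
    rw [← sub_sub, exp_sub_pi_I, sub_eq_add_neg, Complex.exp_add]
  simp only [altIntegrand, recIntegrand, hy, kernelDCy, kernelCDy, he, gammaIntegrand,
    Complex.exp_add _ (-(Complex.exp _ * Complex.exp _))]
  rw [← kernelDC, ← kernelCD, Complex.cpow_neg]
  set K := kernelDC r x (zContour t)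
  set K' := kernelCD r (zContour t) x'
  set A₀ := (∑ i, (x i : ℂ)) + (∑ i, (x' i : ℂ)) - 2 * ∑ i, zContour t i
  have h1 : Complex.exp (Complex.I * lam * (A₀ + 2 * (w + Real.pi * Complex.I)))
      = Complex.exp (-(2 * Real.pi * lam)) * Complex.exp (Complex.I * lam * A₀)
        * Complex.exp (-(-(2 * Complex.I * lam) * w)) := by
    rw [← Complex.exp_add, ← Complex.exp_add]
    congr 1
    linear_combination (2 * lam * Real.pi) * Complex.I_sq
  have h2 : Complex.exp (-(((Real.exp (-x (Fin.last (r + 1)))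
        + Real.exp (-x' (Fin.last r)) : ℝ) : ℂ) * Complex.exp (-w)))
      = Complex.exp (-(Complex.exp (-(x (Fin.last (r + 1)) : ℂ)) * Complex.exp (-w)))
        * Complex.exp (-(Complex.exp (-(x' (Fin.last r) : ℂ)) * Complex.exp (-w))) := by
    rw [← Complex.exp_add]
    push_cast
    congr 1
    ring
  rw [h1, h2]
  have h3 : (((Real.exp (-x (Fin.last (r + 1)))
        + Real.exp (-x' (Fin.last r)) : ℝ) : ℂ) ^ (2 * Complex.I * lam)) ≠ 0 := by
    rw [Complex.cpow_def_of_ne_zero hS']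
    exact Complex.exp_ne_zero _
  generalize (((Real.exp (-x (Fin.last (r + 1)))
    + Real.exp (-x' (Fin.last r)) : ℝ) : ℂ) ^ (2 * Complex.I * lam)) = P at h3 ⊢
  field_simp

theorem recKernel_eq_altIntegral (hθ : |θ| < Real.pi / 2)
    (hlam : 0 < (lam * Complex.exp (θ * Complex.I)).im) :
    Integrable (altIntegrand r lam θ x x') ∧
    recKernel r lam x x'
      = Complex.exp (2 * Real.pi * lam) / Complex.Gamma (-(2 * Complex.I * lam))
        * ∫ p, altIntegrand r lam θ x x' p := by
  have hS : (0 : ℝ) < Real.exp (-x (Fin.last (r + 1))) + Real.exp (-x' (Fin.last r)) := by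
    positivity
  have hS' : ((Real.exp (-x (Fin.last (r + 1))) + Real.exp (-x' (Fin.last r)) : ℝ) : ℂ) ≠ 0 := by
    exact_mod_cast hS.ne'
  -- The condition Im(λe^{iθ}) > 0 is exactly decay along the ray.
  have ha : 0 < (-(2 * Complex.I * lam) * Complex.exp (θ * Complex.I)).re := by
    rw [show -(2 * Complex.I * lam) * Complex.exp (θ * Complex.I)
      = ((-2 : ℝ) : ℂ) * (Complex.I * (lam * Complex.exp (θ * Complex.I))) by push_cast; ring,
      Complex.re_ofReal_mul, Complex.I_mul_re]
    linarith
  have hcos : 0 ≤ (Complex.exp (θ * Complex.I)).re := by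
    rw [Complex.exp_ofReal_mul_I_re]
    exact Real.cos_nonneg_of_mem_Icc ⟨by linarith [(abs_lt.1 hθ).1], (abs_lt.1 hθ).2.le⟩
  -- At a pole a = -n the real part of a e^{iθ} would be -n cos θ ≤ 0.
  have hΓ : Complex.Gamma (-(2 * Complex.I * lam)) ≠ 0 := by
    refine Complex.Gamma_ne_zero fun n hn => ?_
    rw [hn, show (-(n : ℂ)) = ((-n : ℝ) : ℂ) by push_cast; rfl, Complex.re_ofReal_mul] at ha
    have : 0 ≤ (n : ℝ) * (Complex.exp (θ * Complex.I)).re := by positivity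
    linarith
  obtain ⟨h1, h2⟩ := yContour_gammaIntegrand hS hθ ha
  have h3 := (integrable_recIntegrand r lam x x').const_mul
    (Complex.exp (-(2 * Real.pi * lam))
      * ((Real.exp (-x (Fin.last (r + 1))) + Real.exp (-x' (Fin.last r)) : ℝ) : ℂ)
        ^ (-(2 * Complex.I * lam)))
  rw [funext (altIntegrand_eq r lam θ x x')]
  refine ⟨h3.mul_prod h1, ?_⟩
  beta_reduce
  have h6 := integral_prod_mul (μ := volume) (ν := volume)
    (fun t => Complex.exp (-(2 * Real.pi * lam))
      * ((Real.exp (-x (Fin.last (r + 1))) + Real.exp (-x' (Fin.last r)) : ℝ) : ℂ)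
        ^ (-(2 * Complex.I * lam)) * recIntegrand r lam x x' t)
    (fun s => gammaIntegrand (Real.exp (-x (Fin.last (r + 1))) + Real.exp (-x' (Fin.last r)))
      (-(2 * Complex.I * lam)) (yContour θ s - Real.pi * Complex.I) * yVelocity θ s)
  rw [Measure.volume_eq_prod, h6, h2, integral_const_mul, ← recKernel, Complex.exp_neg, neg_neg, Complex.cpow_neg]
  have h4 : (((Real.exp (-x (Fin.last (r + 1)))
        + Real.exp (-x' (Fin.last r)) : ℝ) : ℂ) ^ (2 * Complex.I * lam)) ≠ 0 := by
    rw [Complex.cpow_def_of_ne_zero hS']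
    exact Complex.exp_ne_zero _
  have h5 := Complex.exp_ne_zero (2 * Real.pi * lam)
  generalize (((Real.exp (-x (Fin.last (r + 1)))
    + Real.exp (-x' (Fin.last r)) : ℝ) : ℂ) ^ (2 * Complex.I * lam)) = P at h4 ⊢
  generalize Complex.Gamma (-(2 * Complex.I * lam)) = G at hΓ ⊢
  field_simp

end SecondForm

end

end TodaD

theorem mainTheorem5 (m : ℕ) (lam : Fin (m + 1) → ℂ) :
    -- the integrals over `z` and over the triangular array converge absolutely
    (∀ (k : Fin m) (x : Fin ((k : ℕ) + 2) → ℝ) (x' : Fin ((k : ℕ) + 1) → ℝ),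
      MeasureTheory.Integrable (TodaD.recIntegrand k (lam k.succ) x x')) ∧
    (∀ x : Fin (m + 1) → ℝ, MeasureTheory.Integrable (TodaD.waveIntegrand m lam x)) ∧
    -- the eigenfunction equation
    ContDiff ℝ 2 (TodaD.wave m lam) ∧
    (∀ x : Fin (m + 1) → ℝ,
      TodaD.hamiltonian m (TodaD.wave m lam) x
        = (1 / 2 : ℂ) * (∑ i, lam i ^ 2) * TodaD.wave m lam x) ∧
    -- the second form of the recursive kernel
    (∀ (k : Fin m) (θ : ℝ), |θ| < Real.pi / 2 →
      0 < (lam k.succ * Complex.exp (θ * Complex.I)).im →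
      ∀ (x : Fin ((k : ℕ) + 2) → ℝ) (x' : Fin ((k : ℕ) + 1) → ℝ),
        MeasureTheory.Integrable (TodaD.altIntegrand k (lam k.succ) θ x x') ∧
        TodaD.recKernel k (lam k.succ) x x'
          = Complex.exp (2 * Real.pi * lam k.succ) / Complex.Gamma (-(2 * Complex.I * lam k.succ))
            * ∫ p, TodaD.altIntegrand k (lam k.succ) θ x x' p) := by
  obtain ⟨h1, h2⟩ := TodaD.tame_wave_and_hamiltonian_wave m lam
  exact ⟨fun k x x' => TodaD.integrable_recIntegrand k (lam k.succ) x x',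
    (TodaD.integrable_waveIntegrand_and_bound m lam).1, h1.contDiff, h2,
    fun k θ hθ hlam x x' => TodaD.recKernel_eq_altIntegral k (lam k.succ) θ x x' hθ hlam⟩
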